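/- For $a\in\mathbb R$ let $\mathcal R_a=(\mathbb R,<,+,\mathbb Z,\mathbb Z a)$, and let $\mathcal B=(\mathbb N,\mathcal P(\mathbb N),s_{\mathbb N},\in)$ be the two-sorted B\"uchi structure, where $\mathbb N=\{0,1,2,\dots\}$, $s_{\mathbb N}$ is the successor function and $\in$ is the membership relation between $\mathbb N$ and $\mathcal P(\mathbb N)$. Definable means definable without parameters. **(1)** For every irrational $a\in\mathbb R$, the structure $\mathcal R_a$ defines an isomorphic copy of $\mathcal B$: there are definable sets $S\subseteq\mathbb R^m$ and $T\subseteq\mathbb R^n$, a function $S\to S$ with definable graph, and a definable relation between $S$ and $T$, such that the resulting two-sorted structure is isomorphic to $\mathcal B$. **(2)** Let moreover $\tfrac32<a<2$. Let $[a_0;a_1,a_2,\dots]$ be the continued fraction expansion of $a$, $p_k/q_k$ (in lowest terms, $q_k>0$) its $k$-th convergent, $\beta_k=q_ka-p_k$ and $I=[1-a,2-a)$. Let $U$ be the set of pairs $(p,qa)$ with $p,q\in\mathbb N$, $q\ge1$, such that $|q'a-p'|>|qa-p|$ for all $(p',q')\in\mathbb N^2$ with $1\le q'\le q$ and $(p',q')\ne(p,q)$.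 Then: * $U$ is definable in $\mathcal R_a$, and its projection to the second coordinate is $\{q_ka : k\ge1\}$; in particular the latter set is definable in $\mathcal R_a$. * Every $c\in I$ has a unique Ostrowski representation $c=\sum_{k=0}^\infty b_{k+1}\beta_k$, that is, one with $b_k\in\mathbb N$, $b_1<a_1$, $b_k\le a_k$ for $k>1$, $b_k=0$ whenever $b_{k+1}=a_{k+1}$, and $b_k<a_k$ for infinitely many odd $k$. Write $b_k(c)$ for its digits. For $i\in\{0,1\}$ the set $E_i=\{(q_la,c) : l\ge1,\ c\in I,\ b_{l+1}(c)=i\}$ is definable in $\mathcal R_a$. * Let $W=\{q_la : l\text{ odd}\}$, let $s_W$ be the successor function of the ordered set $(W,<)$, and let $J'$ be the set of all $c\in I$ with $b_{l+1}(c)\in\{0,1\}$ for all $l\ge1$ and $b_{l+1}(c)=0$ for all even $l\ge1$. Then $W$, $J'$ and the graph of $s_W$ are definable in $\mathcal R_a$; the map $h_1:W\to\mathbb N$, $q_la\mapsto\frac{l-1}2$, is well defined; and, with $h_2:J'\to\mathcal P(\mathbb N)$, $h_2(c)=\{\frac{l-1}2 : l\text{ odd},\ (q_la,c)\in E_1\}$,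 the pair $(h_1,h_2)$ is an isomorphism from $(W,J',s_W,E_1)$ (with $E_1$ restricted to $W\times J'$) to $\mathcal B$. -/

import Mathlib

/-! ### The structure `(ℝ, <, +, ℤ, ℤa)` -/

/-- Function symbols: one binary symbol `+`. -/
inductive LatticeFunc : ℕ → Type
  | add : LatticeFunc 2

/-- Relation symbols: a binary `<` and two unary predicates, for `ℤ` and for `ℤa`. -/
inductive LatticeRel : ℕ → Type
  | lt : LatticeRel 2
  | isInt : LatticeRel 1
  | isIntMul : LatticeRel 1

/-- The first-order language of the structures `(ℝ, <, +, ℤ, ℤa)`. -/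
def latticeLang : FirstOrder.Language.{0, 0} := ⟨LatticeFunc, LatticeRel⟩

/-- The structure `R_a = (ℝ, <, +, ℤ, ℤa)`. -/
@[reducible] noncomputable def structR (a : ℝ) : latticeLang.Structure ℝ where
  funMap := fun f => match f with
    | LatticeFunc.add => fun v => v 0 + v 1
  RelMap := fun r => match r with
    | LatticeRel.lt => fun v => v 0 < v 1
    | LatticeRel.isInt => fun v => ∃ n : ℤ, v 0 = n
    | LatticeRel.isIntMul => fun v => ∃ n : ℤ, v 0 = n * a

/-- `S ⊆ ℝ` is definable without parameters in `R_a`. -/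
def DefinableInR₁ (a : ℝ) (S : Set ℝ) : Prop :=
  @Set.Definable₁ ℝ ∅ latticeLang (structR a) S

/-- `S ⊆ ℝ²` is definable without parameters in `R_a`. -/
def DefinableInR₂ (a : ℝ) (S : Set (ℝ × ℝ)) : Prop :=
  @Set.Definable₂ ℝ ∅ latticeLang (structR a) S

/-! ### The Büchi structure and its definable copies -/

/-- A two-sorted structure with sorts `N` and `P`, a unary function on `N` and a binary relation
between `N` and `P`. -/
structure BuchiSig (N P : Type*) where
  /-- the unary function on the first sort -/
  succ : N → N
  /-- the relation between the two sorts -/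
  mem : N → P → Prop

/-- The Büchi structure `B = (ℕ, 𝒫(ℕ), s_ℕ, ∈)`. -/
def buchi : BuchiSig ℕ (Set ℕ) where
  succ := fun n => n + 1
  mem := fun t X => t ∈ X

/-- The pair `(h₁, h₂)` is an isomorphism of two-sorted structures. -/
structure BuchiSig.IsIso {N P N' P' : Type*} (A : BuchiSig N P) (B : BuchiSig N' P')
    (h₁ : N → N') (h₂ : P → P') : Prop where
  bijective_fst : Function.Bijective h₁
  bijective_snd : Function.Bijective h₂
  map_succ : ∀ x, h₁ (A.succ x) = B.succ (h₁ x)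
  map_mem : ∀ x c, A.mem x c ↔ B.mem (h₁ x) (h₂ c)

/-- A two-sorted structure whose sorts are sets `S ⊆ M^m` and `T ⊆ M^n` is definable in the
`L`-structure `M`: the sorts, the graph of the function and the relation are definable in `M`
without parameters. -/
structure BuchiSig.IsDefinable (L : FirstOrder.Language) {M : Type*} [L.Structure M] {m n : ℕ}
    {S : Set (Fin m → M)} {T : Set (Fin n → M)} (A : BuchiSig S T) : Prop where
  fst_sort : (∅ : Set M).Definable L S
  snd_sort : (∅ : Set M).Definable L T
  succ : (∅ : Set M).Definable L
    {v : Fin m ⊕ Fin m → M | ∃ x : S, v = Sum.elim (x : Fin m → M) (A.succ x : Fin m → M)}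
  mem : (∅ : Set M).Definable L
    {v : Fin m ⊕ Fin n → M |
      ∃ (x : S) (c : T), A.mem x c ∧ v = Sum.elim (x : Fin m → M) (c : Fin n → M)}

/-- The `L`-structure `M` defines (without parameters) an isomorphic copy of the Büchi
structure. -/
def DefinesCopyOfBuchi (L : FirstOrder.Language) (M : Type*) [L.Structure M] : Prop :=
  ∃ (m n : ℕ) (S : Set (Fin m → M)) (T : Set (Fin n → M)) (A : BuchiSig S T),
    A.IsDefinable L ∧ ∃ (h₁ : S → ℕ) (h₂ : T → Set ℕ), A.IsIso buchi h₁ h₂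

/-! ### Continued fractions, best approximations, Ostrowski digits -/

/-- The partial quotient `a_k` of the continued fraction expansion `[a_0; a_1, a_2, …]` of an
irrational `a`: the integer part of the `k`-th complete quotient. -/
noncomputable def partialQuot (a : ℝ) (k : ℕ) : ℤ :=
  ⌊(fun x : ℝ => (Int.fract x)⁻¹)^[k] a⌋

/-- The denominator `q_k` of the `k`-th convergent `p_k / q_k = [a_0; a_1, …, a_k]` of `a`. -/
noncomputable def convDen (a : ℝ) (k : ℕ) : ℕ := (a.convergent k).den

/-- The numerator `p_k` of the `k`-th convergent of `a`. -/
noncomputable def convNum (a : ℝ) (k : ℕ) : ℤ := (a.convergent k).num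

/-- The `k`-th difference `β_k = q_k a - p_k`. -/
noncomputable def convDiff (a : ℝ) (k : ℕ) : ℝ := convDen a k * a - convNum a k

/-- The set of all pairs `(p, qa)`, with `p, q ∈ ℕ` and `q ≥ 1`, such that `|q'a - p'| > |qa - p|`
for all other `p', q' ∈ ℕ` with `1 ≤ q' ≤ q`. -/
def bestApprox (a : ℝ) : Set (ℝ × ℝ) :=
  {z | ∃ p q : ℕ, 1 ≤ q ∧ z = ((p : ℝ), (q : ℝ) * a) ∧
    ∀ p' q' : ℕ, 1 ≤ q' → q' ≤ q → (p, q) ≠ (p', q') →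
      |(q : ℝ) * a - p| < |(q' : ℝ) * a - p'|}

/-- The projection of the set of best approximations to the second coordinate. -/
def bestDen (a : ℝ) : Set ℝ := Prod.snd '' bestApprox a

/-- `b` is the digit sequence of an Ostrowski representation of `c` based on `a`. Digits are
indexed by the differences they multiply: `c = ∑ b k * β_k`, so `b k` is the digit usually written
`b_{k+1}`. -/
structure IsOstrowski (a : ℝ) (b : ℕ → ℕ) (c : ℝ) : Prop where
  zero_lt : (b 0 : ℤ) < partialQuot a 1
  le : ∀ k, (b k : ℤ) ≤ partialQuot a (k + 1)
  carry : ∀ k, (b (k + 1) : ℤ) = partialQuot a (k + 2) → b k = 0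
  infinite : ∀ n, ∃ k, n ≤ k ∧ Even k ∧ (b k : ℤ) < partialQuot a (k + 1)
  hasSum : HasSum (fun k => (b k : ℝ) * convDiff a k) c

/-- The set of pairs `(q_l a, c)` with `l ≥ 1` and `c ∈ [1 - a, 2 - a)`, such that `i` is the digit
of `c` at `β_l`. -/
def digitRel (a : ℝ) (i : ℕ) : Set (ℝ × ℝ) :=
  {z | z.2 ∈ Set.Ico (1 - a) (2 - a) ∧
    ∃ l b, 1 ≤ l ∧ z.1 = convDen a l * a ∧ IsOstrowski a b z.2 ∧ b l = i}

/-- The set `W` of all `q_l a` with `l` odd. -/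
def oddDen (a : ℝ) : Set ℝ := {x | ∃ l, Odd l ∧ x = convDen a l * a}

/-- The set `J'` of all `c ∈ [1 - a, 2 - a)` whose digit at `β_l` is `0` or `1` for every `l ≥ 1`,
and `0` for every even `l ≥ 1`. -/
def oddDigitSet (a : ℝ) : Set ℝ :=
  {c | c ∈ Set.Ico (1 - a) (2 - a) ∧ ∃ b, IsOstrowski a b c ∧
    ∀ l, 1 ≤ l → (b l = 0 ∨ b l = 1) ∧ (Even l → b l = 0)}

/-! The best approximations `(p_l, q_l a)` are cut out by a first-order condition, so the structure
sees the sequence `q_l a` with its order. If `c = ∑ b_{k+1} β_k` and `n = ∑_{k ≤ l} b_{k+1} q_k`,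
the remainder of the series after the term at `β_l` differs from `c - n a` by an integer and lies in
a half-open interval with endpoints determined by `β_l`, `β_{l+1}` and whether `n < q_l`. Among the
numbers below `q_{l+1}` only one has this property: two of them could only differ by `q_l`, as the
`q_k` are denominators of best approximations, and this is excluded because the interval shrinks by
`|β_{l+1}|` once `q_l ≤ n`. So `n` is definable from two consecutive best approximations, and so is
the digit `b_{l+1} = ⌊n / q_l⌋`, since `i • x ≤ y < (i + 1) • x` is a first-order condition for each
fixed `i`.

If the digits at even places vanish, then those at odd places may be chosen freely in `{0, 1}`,
since no carry condition connects them; this gives all subsets of `ℕ`. A general irrational `a` is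
moved into `(3/2, 2)` by a nonzero rational factor `r`, as `ℤ r a` is definable from `ℤ a`. -/

/-! ### Continued fractions -/

section ContinuedFraction

variable {x : ℝ}

theorem irrational_fract_inv (hx : Irrational x) : Irrational (Int.fract x)⁻¹ :=
  irrational_inv_iff.2 (hx.sub_intCast _)

theorem fract_pos_of_irrational (hx : Irrational x) : 0 < Int.fract x :=
  Int.fract_pos.2 (hx.ne_int _)

theorem one_lt_fract_inv (hx : Irrational x) : 1 < (Int.fract x)⁻¹ :=
  (one_lt_inv₀ (fract_pos_of_irrational hx)).2 (Int.fract_lt_one x)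

theorem partialQuot_succ (x : ℝ) (k : ℕ) :
    partialQuot x (k + 1) = partialQuot (Int.fract x)⁻¹ k := rfl

theorem one_le_partialQuot_succ (hx : Irrational x) (k : ℕ) : 1 ≤ partialQuot x (k + 1) := by
  induction k generalizing x with
  | zero => exact Int.le_floor.2 (by exact_mod_cast (one_lt_fract_inv hx).le)
  | succ _ ih => exact ih (irrational_fract_inv hx)

theorem convNum_zero (x : ℝ) : convNum x 0 = ⌊x⌋ := by simp [convNum]

theorem convDen_zero (x : ℝ) : convDen x 0 = 1 := by simp [convDen]

theorem convDen_pos (x : ℝ) (k : ℕ) : 0 < convDen x k := (x.convergent k).den_pos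

theorem den_int_add_inv (z : ℤ) {r : ℚ} (hr : 0 < r.num) : (((z : ℚ) + r⁻¹).den : ℤ) = r.num := by
  rw [Rat.intCast_add_den, Rat.den_inv_of_ne_zero (Rat.num_ne_zero.1 hr.ne'),
    Int.natAbs_of_nonneg hr.le]

theorem num_int_add_inv (z : ℤ) {r : ℚ} (hr : 0 < r.num) :
    ((z : ℚ) + r⁻¹).num = z * r.num + r.den := by
  have hden : (((z : ℚ) + r⁻¹).den : ℚ) = r.num := by exact_mod_cast den_int_add_inv z hr
  have hinv : r.num * r⁻¹ = r.den := by
    rw [← div_eq_mul_inv, div_eq_iff (Rat.num_ne_zero.1 hr.ne'), Rat.den_mul_eq_num]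
  have := Rat.mul_den_eq_num ((z : ℚ) + r⁻¹)
  rw [hden, add_mul, mul_comm r⁻¹, hinv] at this
  exact_mod_cast this.symm

theorem convNum_pos (hx : Irrational x) (h : 1 < x) (k : ℕ) : 0 < convNum x k := by
  induction k generalizing x with
  | zero => simpa only [convNum_zero] using Int.floor_pos.2 h.le
  | succ k ih =>
    have hpos := ih (irrational_fract_inv hx) (one_lt_fract_inv hx)
    rw [convNum, Real.convergent_succ, num_int_add_inv _ hpos]
    have := mul_pos (Int.floor_pos.2 h.le) hpos
    rw [convNum] at this
    positivity

theorem convNum_succ (hx : Irrational x) (k : ℕ) :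
    convNum x (k + 1) = ⌊x⌋ * convNum (Int.fract x)⁻¹ k + convDen (Int.fract x)⁻¹ k :=
  num_int_add_inv ⌊x⌋ (convNum_pos (irrational_fract_inv hx) (one_lt_fract_inv hx) k)

theorem convDen_succ (hx : Irrational x) (k : ℕ) :
    (convDen x (k + 1) : ℤ) = convNum (Int.fract x)⁻¹ k :=
  den_int_add_inv ⌊x⌋ (convNum_pos (irrational_fract_inv hx) (one_lt_fract_inv hx) k)

theorem convNum_nonneg (hx : Irrational x) (h : 0 < x) (k : ℕ) : 0 ≤ convNum x k := by
  cases k with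
  | zero => simpa only [convNum_zero] using Int.floor_nonneg.2 h.le
  | succ k =>
    rw [convNum_succ hx]
    have := convNum_pos (irrational_fract_inv hx) (one_lt_fract_inv hx) k
    have := Int.floor_nonneg.2 h.le
    positivity

theorem convDen_one (hx : Irrational x) : (convDen x 1 : ℤ) = partialQuot x 1 := by
  rw [convDen_succ hx, convNum_zero, partialQuot_succ, partialQuot, Function.iterate_zero_apply]

theorem convNum_convDen_add_two (hx : Irrational x) (k : ℕ) :
    convNum x (k + 2) = partialQuot x (k + 2) * convNum x (k + 1) + convNum x k ∧
    (convDen x (k + 2) : ℤ) = partialQuot x (k + 2) * convDen x (k + 1) + convDen x k := by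
  induction k generalizing x with
  | zero =>
    have hx' := irrational_fract_inv hx
    have hquot : partialQuot x (0 + 2) = ⌊(Int.fract (Int.fract x)⁻¹)⁻¹⌋ := rfl
    simp only [convNum_succ, convDen_succ, hx, hx', convNum_zero, convDen_zero, hquot]
    constructor <;> push_cast <;> ring
  | succ k ih =>
    obtain ⟨hnum, hden⟩ := ih (irrational_fract_inv hx)
    rw [convNum_succ hx (k + 2), convNum_succ hx (k + 1), convNum_succ hx k,
      convDen_succ hx (k + 2), convDen_succ hx (k + 1), convDen_succ hx k, hnum, hden,
      partialQuot_succ x (k + 2)]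
    constructor <;> ring

theorem convNum_mul_convDen_succ_sub (hx : Irrational x) (k : ℕ) :
    convNum x k * convDen x (k + 1) - convNum x (k + 1) * convDen x k = -(-1) ^ k := by
  induction k generalizing x with
  | zero =>
    simp only [convNum_succ hx, convDen_succ hx, convNum_zero, convDen_zero]
    push_cast; ring
  | succ k ih =>
    have h := ih (irrational_fract_inv hx)
    rw [convNum_succ hx (k + 1), convNum_succ hx k, convDen_succ hx (k + 1), convDen_succ hx k,
      pow_succ]
    linear_combination -h

theorem convDen_lt_succ (hx : Irrational x) (k : ℕ) : convDen x (k + 1) < convDen x (k + 2) := by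
  have hrec := (convNum_convDen_add_two hx k).2
  have hquot := one_le_partialQuot_succ hx (k + 1)
  have hpos := convDen_pos x k
  zify at *
  nlinarith

theorem convDen_succ_strictMono (hx : Irrational x) : StrictMono fun k => convDen x (k + 1) :=
  strictMono_nat_of_lt_succ (convDen_lt_succ hx)

/-- The distance `|q_{l-1} a - p_{l-1}|` of `a` from its convergents, shifted by one so that
the sequence starts with the value `1` belonging to `p_{-1} / q_{-1} = 1 / 0`. -/
noncomputable def gap : ℝ → ℕ → ℝ
  | _, 0 => 1
  | x, l + 1 => Int.fract x * gap (Int.fract x)⁻¹ l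

theorem gap_zero (x : ℝ) : gap x 0 = 1 := rfl

theorem gap_succ (x : ℝ) (l : ℕ) : gap x (l + 1) = Int.fract x * gap (Int.fract x)⁻¹ l := rfl

theorem gap_one (x : ℝ) : gap x 1 = Int.fract x := mul_one _

theorem gap_pos (hx : Irrational x) (l : ℕ) : 0 < gap x l := by
  induction l generalizing x with
  | zero => exact one_pos
  | succ l ih => exact mul_pos (fract_pos_of_irrational hx) (ih (irrational_fract_inv hx))

theorem gap_eq_add (hx : Irrational x) (l : ℕ) :
    gap x l = partialQuot x (l + 1) * gap x (l + 1) + gap x (l + 2) := by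
  induction l generalizing x with
  | zero =>
    have hfract := (fract_pos_of_irrational hx).ne'
    have hsplit := Int.floor_add_fract (Int.fract x)⁻¹
    rw [gap_succ x 1, gap_one, gap_one, partialQuot_succ, gap_zero, mul_comm _ (Int.fract x),
      ← mul_add]
    exact ((congrArg (Int.fract x * ·) hsplit).trans (mul_inv_cancel₀ hfract)).symm
  | succ l ih =>
    rw [gap_succ, ih (irrational_fract_inv hx), gap_succ x (l + 1), gap_succ x (l + 2),
      partialQuot_succ x (l + 1)]
    ring

theorem gap_add_le (hx : Irrational x) (l : ℕ) : gap x (l + 1) + gap x (l + 2) ≤ gap x l := by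
  have hquot : (1 : ℝ) ≤ partialQuot x (l + 1) := by exact_mod_cast one_le_partialQuot_succ hx l
  have := gap_pos hx (l + 1)
  rw [gap_eq_add hx l]
  nlinarith

theorem antitone_gap (hx : Irrational x) : Antitone (gap x) :=
  antitone_nat_of_succ_le fun l => by linarith [gap_add_le hx l, gap_pos hx (l + 2)]

theorem tendsto_gap (hx : Irrational x) : Filter.Tendsto (gap x) Filter.atTop (nhds 0) := by
  have hhalf : ∀ l, gap x (l + 2) ≤ 2⁻¹ * gap x l := fun l => by
    linarith [gap_add_le hx l, antitone_gap hx (Nat.le_succ (l + 1))]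
  have hbound : ∀ l, gap x (2 * l) ≤ 2⁻¹ ^ l := fun l => by
    induction l with
    | zero => simp [gap_zero]
    | succ l ih => rw [pow_succ', mul_add_one]; linarith [hhalf (2 * l)]
  refine tendsto_atTop_isGLB (antitone_gap hx) ⟨?_, fun y hy => ?_⟩
  · rintro _ ⟨l, rfl⟩
    exact (gap_pos hx l).le
  · exact ge_of_tendsto' (tendsto_pow_atTop_nhds_zero_of_lt_one (by norm_num) (by norm_num))
      fun l => (hy ⟨2 * l, rfl⟩).trans (hbound l)

theorem convDiff_eq (hx : Irrational x) (k : ℕ) : convDiff x k = (-1) ^ k * gap x (k + 1) := by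
  induction k generalizing x with
  | zero => simp [convDiff, convNum_zero, convDen_zero, gap_one]
  | succ k ih =>
    have hfract := (fract_pos_of_irrational hx).ne'
    have hden : ((convDen x (k + 1) : ℕ) : ℝ) = convNum (Int.fract x)⁻¹ k := by
      exact_mod_cast convDen_succ hx k
    calc convDiff x (k + 1)
        = convNum (Int.fract x)⁻¹ k * (x - ⌊x⌋) - convDen (Int.fract x)⁻¹ k := by
          rw [convDiff, hden, convNum_succ hx]; push_cast; ring
      _ = -(Int.fract x * convDiff (Int.fract x)⁻¹ k) := by
          rw [Int.self_sub_floor, convDiff]; field_simp; ring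
      _ = (-1) ^ (k + 1) * gap x (k + 2) := by
          rw [ih (irrational_fract_inv hx), gap_succ x (k + 1)]; ring

/-- The differences `β_{-1}, β_0, β_1, …` of the convergents, starting with the value `β_{-1} = -1`
that belongs to `p_{-1} / q_{-1} = 1 / 0`. -/
noncomputable def prevDiff (a : ℝ) : ℕ → ℝ
  | 0 => -1
  | k + 1 => convDiff a k

theorem prevDiff_zero (a : ℝ) : prevDiff a 0 = -1 := rfl

theorem prevDiff_succ (a : ℝ) (k : ℕ) : prevDiff a (k + 1) = convDiff a k := rfl

theorem prevDiff_eq (hx : Irrational x) (l : ℕ) : prevDiff x l = -(-1) ^ l * gap x l := by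
  cases l with
  | zero => simp [prevDiff, gap_zero]
  | succ l => rw [prevDiff_succ, convDiff_eq hx]; ring

theorem abs_prevDiff (hx : Irrational x) (l : ℕ) : |prevDiff x l| = gap x l := by
  rw [prevDiff_eq hx, abs_mul, abs_neg, abs_neg_one_pow, one_mul, abs_of_pos (gap_pos hx l)]

theorem prevDiff_add_two (hx : Irrational x) (l : ℕ) :
    prevDiff x (l + 2) = prevDiff x l + partialQuot x (l + 1) * prevDiff x (l + 1) := by
  rw [prevDiff_eq hx, prevDiff_eq hx, prevDiff_eq hx, gap_eq_add hx l]; ring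

theorem prevDiff_mul_prevDiff_succ_neg (hx : Irrational x) (l : ℕ) :
    prevDiff x l * prevDiff x (l + 1) < 0 := by
  have hsign : ((-1) ^ l * (-1) ^ l : ℝ) = 1 := by rw [← mul_pow]; simp
  have : prevDiff x l * prevDiff x (l + 1) = -(gap x l * gap x (l + 1)) := by
    rw [prevDiff_eq hx, prevDiff_eq hx, pow_succ]
    linear_combination -(gap x l * gap x (l + 1)) * hsign
  rw [this, neg_lt_zero]
  exact mul_pos (gap_pos hx l) (gap_pos hx (l + 1))

theorem prevDiff_neg_iff (hx : Irrational x) (l : ℕ) : prevDiff x l < 0 ↔ Even l := by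
  have := gap_pos hx l
  rcases l.even_or_odd with h | h
  · simp [prevDiff_eq hx, h.neg_one_pow, h, this]
  · simp [prevDiff_eq hx, h.neg_one_pow, Nat.not_even_iff_odd.2 h, this.le]

theorem prevDiff_pos_iff (hx : Irrational x) (l : ℕ) : 0 < prevDiff x l ↔ Odd l := by
  have := gap_pos hx l
  rcases l.even_or_odd with h | h
  · simp [prevDiff_eq hx, h.neg_one_pow, Nat.not_odd_iff_even.2 h, this.le]
  · simp [prevDiff_eq hx, h.neg_one_pow, h, this]

end ContinuedFraction

/-! ### Best approximations -/

section BestApproximation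

variable {a : ℝ}

theorem exists_eq_mul_conv_add (ha : Irrational a) (k : ℕ) (m P : ℤ) : ∃ u v : ℤ,
    m = u * convDen a k + v * convDen a (k + 1) ∧
    P = u * convNum a k + v * convNum a (k + 1) := by
  have hdet := convNum_mul_convDen_succ_sub ha k
  have hsign : ((-1) ^ k * (-1) ^ k : ℤ) = 1 := by rw [← mul_pow]; simp
  refine ⟨(-1) ^ k * (convNum a (k + 1) * m - convDen a (k + 1) * P),
    (-1) ^ k * (convDen a k * P - convNum a k * m), ?_, ?_⟩
  · linear_combination (-m) * hsign + (-1) ^ k * m * hdet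
  · linear_combination (-P) * hsign + (-1) ^ k * P * hdet

theorem abs_mul_convDiff_add (ha : Irrational a) (k : ℕ) (u v : ℤ) :
    |u * convDiff a k + v * convDiff a (k + 1)| = |u * gap a (k + 1) - v * gap a (k + 2)| := by
  have : u * convDiff a k + v * convDiff a (k + 1) =
      (-1) ^ k * (u * gap a (k + 1) - v * gap a (k + 2)) := by
    rw [convDiff_eq ha, convDiff_eq ha]; ring
  rw [this, abs_mul, abs_neg_one_pow, one_mul]

theorem abs_convDiff (ha : Irrational a) (k : ℕ) : |convDiff a k| = gap a (k + 1) :=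
  abs_prevDiff ha (k + 1)

-- In the basis `(q_k, p_k)`, `(q_{k+1}, p_{k+1})` of `ℤ²`, a vector with a nonzero second
-- coordinate `v` and `|m| < q_{k+1}` has a first coordinate of the opposite sign, and then the
-- contributions of both coordinates to `m a - P` have the same sign.
theorem exists_eq_mul_conv_of_abs_lt (ha : Irrational a) {k : ℕ} {m P : ℤ}
    (hm : |m| < convDen a (k + 1)) (hP : |m * a - P| < gap a (k + 1) + gap a (k + 2)) :
    ∃ u : ℤ, |u| ≤ 1 ∧ m = u * convDen a k ∧ P = u * convNum a k := by
  obtain ⟨u, v, rfl, rfl⟩ := exists_eq_mul_conv_add ha k m P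
  have hdiff : (u * convDen a k + v * convDen a (k + 1) : ℤ) * a
      - (u * convNum a k + v * convNum a (k + 1) : ℤ)
      = u * convDiff a k + v * convDiff a (k + 1) := by
    simp only [convDiff]; push_cast; ring
  rw [hdiff, abs_mul_convDiff_add ha, abs_lt] at hP
  rw [abs_lt] at hm
  have hden : (0 : ℤ) < convDen a k := by exact_mod_cast convDen_pos a k
  have hgap := gap_pos ha (k + 1)
  have hgap' := gap_pos ha (k + 2)
  rcases lt_trichotomy v 0 with hv | rfl | hv
  · have hu : 1 ≤ u := by by_contra; nlinarith [hden]
    have : (1 : ℝ) ≤ u ∧ (v : ℝ) ≤ -1 := ⟨mod_cast hu, mod_cast (by omega : v ≤ -1)⟩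
    nlinarith
  · refine ⟨u, ?_, by ring, by ring⟩
    have hle := antitone_gap ha (Nat.le_succ (k + 1))
    rw [← Int.lt_add_one_iff, abs_lt]
    constructor <;> by_contra! hu
    · have : (u : ℝ) ≤ -2 := mod_cast hu
      push_cast at hP; nlinarith
    · have : (2 : ℝ) ≤ u := mod_cast hu
      push_cast at hP; nlinarith
  · have hu : u ≤ -1 := by by_contra; nlinarith [hden]
    have : (u : ℝ) ≤ -1 ∧ (1 : ℝ) ≤ v := ⟨mod_cast hu, mod_cast hv⟩
    nlinarith

theorem gap_lt_abs_mul_sub (ha : Irrational a) {k : ℕ} {m P : ℤ} (hm : 0 < m)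
    (hlt : m < convDen a (k + 1)) (hne : (P, m) ≠ (convNum a k, (convDen a k : ℤ))) :
    gap a (k + 1) < |m * a - P| := by
  by_contra! hle
  obtain ⟨u, hu, rfl, rfl⟩ := exists_eq_mul_conv_of_abs_lt ha
    (by rwa [abs_of_pos hm]) (hle.trans_lt (lt_add_of_pos_right _ (gap_pos ha (k + 2))))
  have hu0 : 0 < u := pos_of_mul_pos_left hm (Nat.cast_nonneg _)
  obtain rfl : u = 1 := by rw [abs_of_pos hu0] at hu; omega
  simp at hne

theorem exists_convDen_le_lt (ha : Irrational a) {q : ℕ} (hq : convDen a 1 ≤ q) :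
    ∃ k, convDen a (k + 1) ≤ q ∧ q < convDen a (k + 2) := by
  have hmono := convDen_succ_strictMono ha
  have hmem : q ∈ Set.Ici (convDen a (⊥ + 1)) := hq
  rw [← iUnion_Ico_map_succ_eq_Ici (f := fun k => convDen a (k + 1))
    (fun k => hmono.monotone bot_le)
    (Filter.not_bddAbove_of_tendsto_atTop hmono.tendsto_atTop)] at hmem
  simpa using hmem

theorem convPair_mem_bestApprox (ha : Irrational a) (hpos : 0 < a) (k : ℕ) :
    ((convNum a (k + 1) : ℝ), (convDen a (k + 1) : ℝ) * a) ∈ bestApprox a := by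
  obtain ⟨p, hp⟩ := Int.eq_ofNat_of_zero_le (convNum_nonneg ha hpos (k + 1))
  refine ⟨p, convDen a (k + 1), convDen_pos a _, by simp [hp], fun p' q' hq' hle hne => ?_⟩
  have hlt := gap_lt_abs_mul_sub ha (k := k + 1) (m := q') (P := p') (mod_cast hq')
    (mod_cast hle.trans_lt (convDen_lt_succ ha k)) (by
      rw [hp]; exact fun h => hne (by simp only [Prod.mk.injEq, Nat.cast_inj] at h; simp [h]))
  rw [← abs_convDiff ha, convDiff, hp] at hlt
  exact_mod_cast hlt

theorem eq_convPair_of_mem_bestApprox (ha : Irrational a) (hpos : 0 < a)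
    (hquot : partialQuot a 1 = 1) {z : ℝ × ℝ} (hz : z ∈ bestApprox a) :
    ∃ k, z = ((convNum a (k + 1) : ℝ), (convDen a (k + 1) : ℝ) * a) := by
  obtain ⟨p, q, hq, rfl, hbest⟩ := hz
  have hone : convDen a 1 = 1 := by exact_mod_cast (convDen_one ha).trans hquot
  obtain ⟨k, hle, hlt⟩ := exists_convDen_le_lt ha (hone ▸ hq)
  obtain ⟨p', hp'⟩ := Int.eq_ofNat_of_zero_le (convNum_nonneg ha hpos (k + 1))
  refine ⟨k, ?_⟩
  by_contra hne
  have hcloser : |(q : ℝ) * a - p| < gap a (k + 2) := by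
    rw [← abs_convDiff ha, convDiff, hp']
    exact_mod_cast hbest p' _ (convDen_pos a _) hle fun h => hne (by
      simp only [Prod.mk.injEq] at h; simp [hp', h])
  have hfarther := gap_lt_abs_mul_sub ha (k := k + 1) (m := q) (P := p) (mod_cast hq)
    (mod_cast hlt) fun h => hne (by
      simp only [Prod.mk.injEq, Nat.cast_inj] at h; simp [← h.1, h.2])
  exact lt_asymm hcloser (mod_cast hfarther)

theorem mem_bestApprox_iff (ha : Irrational a) (hpos : 0 < a) (hquot : partialQuot a 1 = 1)
    {z : ℝ × ℝ} : z ∈ bestApprox a ↔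
      ∃ k, z = ((convNum a (k + 1) : ℝ), (convDen a (k + 1) : ℝ) * a) :=
  ⟨eq_convPair_of_mem_bestApprox ha hpos hquot,
    by rintro ⟨k, rfl⟩; exact convPair_mem_bestApprox ha hpos k⟩

theorem bestDen_eq_range (ha : Irrational a) (hpos : 0 < a) (hquot : partialQuot a 1 = 1) :
    bestDen a = Set.range fun k => (convDen a (k + 1) : ℝ) * a := by
  ext x
  simp only [bestDen, Set.mem_image, mem_bestApprox_iff ha hpos hquot, Set.mem_range]
  exact ⟨by rintro ⟨_, ⟨k, rfl⟩, rfl⟩; exact ⟨k, rfl⟩,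
    by rintro ⟨k, rfl⟩; exact ⟨_, ⟨k, rfl⟩, rfl⟩⟩

theorem bestDen_eq_ofPred (ha : Irrational a) (hpos : 0 < a) (hquot : partialQuot a 1 = 1) :
    bestDen a = {x | ∃ k, 1 ≤ k ∧ x = convDen a k * a} := by
  rw [bestDen_eq_range ha hpos hquot]
  ext x
  constructor
  · rintro ⟨k, rfl⟩
    exact ⟨k + 1, k.succ_pos, rfl⟩
  · rintro ⟨k, hk, rfl⟩
    obtain ⟨k, rfl⟩ := Nat.exists_eq_add_of_le' hk
    exact ⟨k, rfl⟩

theorem oddDen_eq_range (a : ℝ) :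
    oddDen a = Set.range fun k => (convDen a (2 * k + 1) : ℝ) * a := by
  ext x
  exact ⟨by rintro ⟨_, ⟨k, rfl⟩, rfl⟩; exact ⟨k, rfl⟩,
    by rintro ⟨k, rfl⟩; exact ⟨_, odd_two_mul_add_one k, rfl⟩⟩

theorem injective_convDen_succ_mul (ha : Irrational a) :
    Function.Injective fun k => (convDen a (k + 1) : ℝ) * a :=
  (mul_left_injective₀ ha.ne_zero).comp
    (Nat.cast_injective.comp (convDen_succ_strictMono ha).injective)

theorem strictMono_convDen_succ_mul (ha : Irrational a) (hpos : 0 < a) :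
    StrictMono fun k => (convDen a (k + 1) : ℝ) * a :=
  fun _ _ h => mul_lt_mul_of_pos_right (mod_cast convDen_succ_strictMono ha h) hpos

theorem injective_convDen_odd_mul (ha : Irrational a) :
    Function.Injective fun k => (convDen a (2 * k + 1) : ℝ) * a :=
  (injective_convDen_succ_mul ha).comp (mul_right_injective₀ two_ne_zero)

theorem strictMono_convDen_odd_mul (ha : Irrational a) (hpos : 0 < a) :
    StrictMono fun k => (convDen a (2 * k + 1) : ℝ) * a :=
  (strictMono_convDen_succ_mul ha hpos).comp (strictMono_mul_left_of_pos two_pos)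

theorem isLeast_range_gt_of_strictMono {α : Type*} [LinearOrder α] {f : ℕ → α}
    (hf : StrictMono f) (n : ℕ) : IsLeast {y ∈ Set.range f | f n < y} (f (n + 1)) := by
  refine ⟨⟨⟨n + 1, rfl⟩, hf n.lt_succ_self⟩, ?_⟩
  rintro _ ⟨⟨m, rfl⟩, hm⟩
  exact hf.monotone (hf.lt_iff_lt.1 hm)

end BestApproximation

/-! ### Ostrowski representations -/

section Remainder

/-- The range of the remainder `r = ∑_{k ≥ l} b_{k+1} β_k` of an Ostrowski expansion, where
`β = β_{l-1}` and `β' = β_l`: a half-open interval, closed on the left, with endpoints `-β'` and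
`-β`, the latter being replaced by `-(β + β')` if `capped` holds, that is, if the next digit may
not be maximal. Since the signs of `β` and `β'` alternate, the order of the endpoints depends on
the sign of `β`, and this form of the inequalities covers both cases. -/
structure IsRemainder (β β' : ℝ) (capped : Prop) (r : ℝ) : Prop where
  near : -β' ≤ r ↔ β < 0
  far : ¬capped → (-β ≤ r ↔ 0 < β)
  far_of_capped : capped → (-(β + β') ≤ r ↔ 0 < β)

variable {β β' r r' : ℝ} {s s' : Prop}

theorem IsRemainder.far_uncapped (h : IsRemainder β β' s r) (hopp : β * β' < 0) :
    -β ≤ r ↔ 0 < β := by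
  by_cases hs : s
  · have := h.near
    have := h.far_of_capped hs
    grind [mul_neg_iff]
  · exact h.far hs

theorem IsRemainder.abs_sub_lt (h : IsRemainder β β' s r) (h' : IsRemainder β β' s' r')
    (hopp : β * β' < 0) : |r - r'| < |β| + |β'| := by
  have := h.near
  have := h'.near
  have := h.far_uncapped hopp
  have := h'.far_uncapped hopp
  rw [abs_sub_lt_iff]
  grind [mul_neg_iff]

theorem IsRemainder.abs_le_max (h : IsRemainder β β' s r)
    (hopp : β * β' < 0) : |r| ≤ max |β| |β'| := by
  have := h.near
  have := h.far_uncapped hopp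
  rw [le_max_iff, abs_le]
  grind [mul_neg_iff]

theorem IsRemainder.not_capped_sub (h : IsRemainder β β' s r) (hβ : β ≠ 0) (hs' : s') :
    ¬IsRemainder β β' s' (r - β) := fun h' => by
  have := h.near
  have := h'.far_of_capped hs'
  grind

/-- The least digit `d` for which `r - d β'` satisfies the bound `IsRemainder.near` of the next
remainder. -/
noncomputable def greedyDigit (β' β'' r : ℝ) : ℕ := sInf {d : ℕ | -β'' ≤ r - d * β' ↔ β' < 0}

theorem IsRemainder.near_sub_mul {A : ℕ} (h : IsRemainder β β' s r) (hopp : β * β' < 0)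
    (hs : ¬s) : -(β + A * β') ≤ r - A * β' ↔ β' < 0 := by
  have := h.far hs
  grind [mul_neg_iff]

theorem IsRemainder.near_sub_pred_mul {A : ℕ} (h : IsRemainder β β' s r) (hopp : β * β' < 0)
    (hA : 1 ≤ A) (hs : s) : -(β + A * β') ≤ r - (A - 1 : ℕ) * β' ↔ β' < 0 := by
  have := h.far_of_capped hs
  push_cast [hA]
  grind [mul_neg_iff]

theorem IsRemainder.exists_near {A : ℕ} (h : IsRemainder β β' s r) (hopp : β * β' < 0)
    (hA : 1 ≤ A) : ∃ d : ℕ, d ≤ A ∧ (s → d < A) ∧ (-(β + A * β') ≤ r - d * β' ↔ β' < 0) := by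
  by_cases hs : s
  · exact ⟨A - 1, A.sub_le 1, fun _ => Nat.sub_one_lt_of_lt hA, h.near_sub_pred_mul hopp hA hs⟩
  · exact ⟨A, le_rfl, fun hs' => absurd hs' hs, h.near_sub_mul hopp hs⟩

theorem IsRemainder.sub_greedyDigit {A : ℕ} (h : IsRemainder β β' s r) (hopp : β * β' < 0)
    (hA : 1 ≤ A) : IsRemainder β' (β + A * β') (greedyDigit β' (β + A * β') r ≠ 0)
      (r - greedyDigit β' (β + A * β') r * β') := by
  obtain ⟨d, -, -, hd⟩ := h.exists_near hopp hA
  have hmin : ∀ e < greedyDigit β' (β + A * β') r, ¬(-(β + A * β') ≤ r - e * β' ↔ β' < 0) :=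
    fun e => Nat.notMem_of_lt_sInf
  refine ⟨Nat.sInf_mem (s := {d : ℕ | -(β + A * β') ≤ r - d * β' ↔ β' < 0}) ⟨d, hd⟩, ?_, ?_⟩
  · intro hzero
    rw [not_not.1 hzero]
    have := h.near
    grind [mul_neg_iff]
  · intro hzero
    obtain ⟨e, he⟩ := Nat.exists_eq_succ_of_ne_zero hzero
    have := hmin e (by omega)
    rw [he]
    push_cast
    grind [mul_neg_iff]

theorem IsRemainder.greedyDigit_le {A : ℕ} (h : IsRemainder β β' s r) (hopp : β * β' < 0)
    (hA : 1 ≤ A) : greedyDigit β' (β + A * β') r ≤ A := by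
  obtain ⟨d, hle, -, hd⟩ := h.exists_near hopp hA
  exact (Nat.sInf_le hd).trans hle

theorem IsRemainder.greedyDigit_lt {A : ℕ} (h : IsRemainder β β' s r) (hopp : β * β' < 0)
    (hA : 1 ≤ A) (hs : s) : greedyDigit β' (β + A * β') r < A := by
  obtain ⟨d, -, hlt, hd⟩ := h.exists_near hopp hA
  exact (Nat.sInf_le hd).trans_lt (hlt hs)

end Remainder

section Remainders

/-- The remainder `c - ∑_{k < l} b_{k+1} β_k`. -/
noncomputable def ostrowskiRem (a : ℝ) (b : ℕ → ℕ) (c : ℝ) (l : ℕ) : ℝ :=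
  c - ∑ k ∈ Finset.range l, b k * convDiff a k

/-- The distance of the remainder `ostrowskiRem a b c l` from the endpoint `-β_{l-1}` of its
range, counted positively inside the range. -/
noncomputable def ostrowskiDefect (a : ℝ) (b : ℕ → ℕ) (c : ℝ) (l : ℕ) : ℝ :=
  gap a l - (-1) ^ l * ostrowskiRem a b c l

variable {a c : ℝ} {b : ℕ → ℕ}

theorem ostrowskiRem_zero (a : ℝ) (b : ℕ → ℕ) (c : ℝ) : ostrowskiRem a b c 0 = c := by
  simp [ostrowskiRem]

theorem ostrowskiRem_succ (a : ℝ) (b : ℕ → ℕ) (c : ℝ) (l : ℕ) :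
    ostrowskiRem a b c (l + 1) = ostrowskiRem a b c l - b l * prevDiff a (l + 1) := by
  rw [ostrowskiRem, Finset.sum_range_succ, ← sub_sub, ostrowskiRem, prevDiff_succ]

theorem ostrowskiDefect_eq (ha : Irrational a) (l : ℕ) :
    ostrowskiDefect a b c l =
      (partialQuot a (l + 1) - b l) * gap a (l + 1) + b (l + 1) * gap a (l + 2)
        + ostrowskiDefect a b c (l + 2) := by
  have hsign : ((-1) ^ l * (-1) ^ l : ℝ) = 1 := by rw [← mul_pow]; simp
  simp only [ostrowskiDefect, ostrowskiRem_succ, prevDiff_eq ha, gap_eq_add ha l, pow_add]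
  linear_combination (b (l + 1) * gap a (l + 2) - b l * gap a (l + 1)) * hsign

theorem ostrowskiDefect_add_two_le (ha : Irrational a) {l : ℕ}
    (hle : (b l : ℤ) ≤ partialQuot a (l + 1)) :
    ostrowskiDefect a b c (l + 2) ≤ ostrowskiDefect a b c l := by
  have hdigit : (b l : ℝ) ≤ partialQuot a (l + 1) := mod_cast hle
  have := mul_nonneg (sub_nonneg.2 hdigit) (gap_pos ha (l + 1)).le
  have := mul_nonneg (b (l + 1)).cast_nonneg (gap_pos ha (l + 2)).le
  linarith [ostrowskiDefect_eq ha (b := b) (c := c) l]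

theorem ostrowskiDefect_add_two_lt (ha : Irrational a) {l : ℕ}
    (hlt : (b l : ℤ) < partialQuot a (l + 1)) :
    ostrowskiDefect a b c (l + 2) < ostrowskiDefect a b c l := by
  have hdigit : (b l : ℝ) < partialQuot a (l + 1) := mod_cast hlt
  have := mul_pos (sub_pos.2 hdigit) (gap_pos ha (l + 1))
  have := mul_nonneg (b (l + 1)).cast_nonneg (gap_pos ha (l + 2)).le
  linarith [ostrowskiDefect_eq ha (b := b) (c := c) l]

theorem antitone_ostrowskiDefect (ha : Irrational a)
    (hle : ∀ k, (b k : ℤ) ≤ partialQuot a (k + 1)) (l : ℕ) :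
    Antitone fun n => ostrowskiDefect a b c (l + 2 * n) :=
  antitone_nat_of_succ_le fun _ => ostrowskiDefect_add_two_le ha (hle _)

theorem tendsto_ostrowskiDefect (ha : Irrational a)
    (hrem : Filter.Tendsto (ostrowskiRem a b c) Filter.atTop (nhds 0)) (l : ℕ) :
    Filter.Tendsto (fun n => ostrowskiDefect a b c (l + 2 * n)) Filter.atTop (nhds 0) := by
  have hdefect : Filter.Tendsto (ostrowskiDefect a b c) Filter.atTop (nhds 0) := by
    have hsigned : Filter.Tendsto (fun l => (-1) ^ l * ostrowskiRem a b c l)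
        Filter.atTop (nhds 0) := by
      refine squeeze_zero_norm (fun l => ?_) (tendsto_zero_iff_norm_tendsto_zero.1 hrem)
      rw [norm_mul, norm_pow, norm_neg, norm_one, one_pow, one_mul]
    simpa using! (tendsto_gap ha).sub hsigned
  exact hdefect.comp
    (Filter.tendsto_atTop_mono (fun n => (by omega : n ≤ l + 2 * n)) Filter.tendsto_id)

theorem ostrowskiDefect_nonneg (ha : Irrational a)
    (hle : ∀ k, (b k : ℤ) ≤ partialQuot a (k + 1))
    (hrem : Filter.Tendsto (ostrowskiRem a b c) Filter.atTop (nhds 0)) (l : ℕ) :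
    0 ≤ ostrowskiDefect a b c l :=
  (antitone_ostrowskiDefect ha hle l).le_of_tendsto (tendsto_ostrowskiDefect ha hrem l) 0

theorem far_iff_ostrowskiDefect (ha : Irrational a) (hnonneg : ∀ l, 0 ≤ ostrowskiDefect a b c l)
    (l : ℕ) : (-prevDiff a l ≤ ostrowskiRem a b c l ↔ 0 < prevDiff a l) ↔
      (Even l → 0 < ostrowskiDefect a b c l) := by
  have hdefect := hnonneg l
  rw [prevDiff_pos_iff ha, prevDiff_eq ha]
  rcases l.even_or_odd with h | h
  · simp [ostrowskiDefect, h.neg_one_pow, h, Nat.not_odd_iff_even.2 h]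
  · simpa [ostrowskiDefect, h.neg_one_pow, h, Nat.not_even_iff_odd.2 h, neg_le_iff_add_nonneg']
      using hdefect

end Remainders

namespace IsOstrowski

variable {a c : ℝ} {b : ℕ → ℕ}

theorem tendsto_ostrowskiRem (h : IsOstrowski a b c) :
    Filter.Tendsto (ostrowskiRem a b c) Filter.atTop (nhds 0) := by
  simpa using! (h.hasSum.tendsto_sum_nat.const_sub c)

theorem ostrowskiDefect_pos_of_even (ha : Irrational a) (h : IsOstrowski a b c) {l : ℕ}
    (hl : Even l) : 0 < ostrowskiDefect a b c l := by
  obtain ⟨k, hk, hkeven, hlt⟩ := h.infinite l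
  obtain ⟨n, rfl⟩ : ∃ n, k = l + 2 * n := by
    obtain ⟨m, rfl⟩ := hl
    obtain ⟨n, rfl⟩ := hkeven
    exact ⟨n - m, by omega⟩
  calc 0 ≤ ostrowskiDefect a b c (l + 2 * n + 2) :=
        ostrowskiDefect_nonneg ha h.le h.tendsto_ostrowskiRem _
    _ < ostrowskiDefect a b c (l + 2 * n) := ostrowskiDefect_add_two_lt ha hlt
    _ ≤ ostrowskiDefect a b c l := antitone_ostrowskiDefect ha h.le l n.zero_le

theorem far (ha : Irrational a) (h : IsOstrowski a b c) (l : ℕ) :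
    -prevDiff a l ≤ ostrowskiRem a b c l ↔ 0 < prevDiff a l :=
  (far_iff_ostrowskiDefect ha (ostrowskiDefect_nonneg ha h.le h.tendsto_ostrowskiRem) l).2
    (h.ostrowskiDefect_pos_of_even ha)

theorem near (ha : Irrational a) (h : IsOstrowski a b c) (l : ℕ) :
    -prevDiff a (l + 1) ≤ ostrowskiRem a b c l ↔ prevDiff a l < 0 := by
  have hfar := h.far ha (l + 1)
  rw [ostrowskiRem_succ] at hfar
  have hdigit : (0 : ℝ) ≤ b l := Nat.cast_nonneg _
  rcases mul_neg_iff.1 (prevDiff_mul_prevDiff_succ_neg ha l) with ⟨hpos, hneg⟩ | ⟨hneg, hpos⟩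
  · have := mul_nonpos_of_nonneg_of_nonpos hdigit hneg.le
    grind
  · have := mul_nonneg hdigit hpos.le
    grind

theorem far_of_lt (ha : Irrational a) (h : IsOstrowski a b c) {l : ℕ}
    (hlt : (b l : ℤ) < partialQuot a (l + 1)) :
    -(prevDiff a l + prevDiff a (l + 1)) ≤ ostrowskiRem a b c l ↔ 0 < prevDiff a l := by
  have hnear := h.near ha (l + 1)
  rw [ostrowskiRem_succ, prevDiff_add_two ha] at hnear
  have hdigit : (0 : ℝ) ≤ partialQuot a (l + 1) - b l - 1 := by
    rw [sub_sub, sub_nonneg]; exact_mod_cast hlt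
  rcases mul_neg_iff.1 (prevDiff_mul_prevDiff_succ_neg ha l) with ⟨hpos, hneg⟩ | ⟨hneg, hpos⟩
  · have := mul_nonpos_of_nonneg_of_nonpos hdigit hneg.le
    grind
  · have := mul_nonneg hdigit hpos.le
    grind

theorem isRemainder_zero (ha : Irrational a) (h : IsOstrowski a b c) :
    IsRemainder (prevDiff a 0) (prevDiff a 1) True c where
  near := by simpa only [ostrowskiRem_zero] using h.near ha 0
  far := fun hfalse => absurd trivial hfalse
  far_of_capped := fun _ => by simpa only [ostrowskiRem_zero] using h.far_of_lt ha h.zero_lt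

theorem isRemainder_succ (ha : Irrational a) (h : IsOstrowski a b c) (j : ℕ) :
    IsRemainder (prevDiff a (j + 1)) (prevDiff a (j + 2)) (b j ≠ 0)
      (ostrowskiRem a b c (j + 1)) where
  near := h.near ha (j + 1)
  far := fun _ => h.far ha (j + 1)
  far_of_capped := fun hj =>
    h.far_of_lt ha (lt_of_le_of_ne (h.le (j + 1)) fun heq => hj (h.carry j heq))

end IsOstrowski

theorem isRemainder_prevDiff_zero_iff {a c : ℝ} :
    IsRemainder (prevDiff a 0) (prevDiff a 1) True c ↔
      c ∈ Set.Ico (-Int.fract a) (1 - Int.fract a) := by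
  have hone : prevDiff a 1 = Int.fract a := by
    simp [prevDiff, convDiff, convNum_zero, convDen_zero]
  rw [hone, prevDiff_zero, Set.mem_Ico]
  constructor
  · intro h
    have := h.near
    have := h.far_of_capped trivial
    grind
  · intro h
    exact ⟨by grind, by grind, by grind⟩

section Existence

variable {a c : ℝ} {b : ℕ → ℕ}

/-- The remainders of the greedy expansion of `c`. -/
noncomputable def greedyRem (a c : ℝ) : ℕ → ℝ
  | 0 => c
  | l + 1 => greedyRem a c l
      - greedyDigit (prevDiff a (l + 1)) (prevDiff a (l + 2)) (greedyRem a c l) * prevDiff a (l + 1)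

/-- The digit of the greedy expansion of `c` at `β_l`. -/
noncomputable def ostrowskiDigit (a c : ℝ) (l : ℕ) : ℕ :=
  greedyDigit (prevDiff a (l + 1)) (prevDiff a (l + 2)) (greedyRem a c l)

theorem ostrowskiRem_ostrowskiDigit (a c : ℝ) (l : ℕ) :
    ostrowskiRem a (ostrowskiDigit a c) c l = greedyRem a c l := by
  induction l with
  | zero => exact ostrowskiRem_zero ..
  | succ l ih => rw [ostrowskiRem_succ, ih]; rfl

theorem greedy_step {s : Prop} {l : ℕ} (ha : Irrational a)
    (h : IsRemainder (prevDiff a l) (prevDiff a (l + 1)) s (greedyRem a c l)) :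
    IsRemainder (prevDiff a (l + 1)) (prevDiff a (l + 2)) (ostrowskiDigit a c l ≠ 0)
        (greedyRem a c (l + 1)) ∧
      (ostrowskiDigit a c l : ℤ) ≤ partialQuot a (l + 1) ∧
      (s → (ostrowskiDigit a c l : ℤ) < partialQuot a (l + 1)) := by
  have hquot := one_le_partialQuot_succ ha l
  have hrec := prevDiff_add_two ha l
  have hopp := prevDiff_mul_prevDiff_succ_neg ha l
  obtain ⟨A, hA⟩ := Int.eq_ofNat_of_zero_le (zero_le_one.trans hquot)
  rw [hA] at hquot hrec ⊢
  simp only [ostrowskiDigit, greedyRem]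
  rw [Int.cast_natCast] at hrec
  rw [hrec]
  norm_cast at hquot ⊢
  exact ⟨h.sub_greedyDigit hopp hquot, h.greedyDigit_le hopp hquot, h.greedyDigit_lt hopp hquot⟩

theorem isRemainder_greedyRem (ha : Irrational a)
    (hc : c ∈ Set.Ico (-Int.fract a) (1 - Int.fract a)) (l : ℕ) :
    IsRemainder (prevDiff a (l + 1)) (prevDiff a (l + 2)) (ostrowskiDigit a c l ≠ 0)
      (greedyRem a c (l + 1)) := by
  induction l with
  | zero => exact (greedy_step ha (isRemainder_prevDiff_zero_iff.2 hc)).1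
  | succ l ih => exact (greedy_step ha ih).1

theorem ostrowskiDigit_zero_lt (ha : Irrational a)
    (hc : c ∈ Set.Ico (-Int.fract a) (1 - Int.fract a)) :
    (ostrowskiDigit a c 0 : ℤ) < partialQuot a 1 :=
  (greedy_step ha (isRemainder_prevDiff_zero_iff.2 hc)).2.2 trivial

theorem ostrowskiDigit_le (ha : Irrational a)
    (hc : c ∈ Set.Ico (-Int.fract a) (1 - Int.fract a)) (l : ℕ) :
    (ostrowskiDigit a c l : ℤ) ≤ partialQuot a (l + 1) := by
  cases l with
  | zero => exact (ostrowskiDigit_zero_lt ha hc).le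
  | succ l => exact (greedy_step ha (isRemainder_greedyRem ha hc l)).2.1

theorem ostrowskiDigit_carry (ha : Irrational a)
    (hc : c ∈ Set.Ico (-Int.fract a) (1 - Int.fract a)) (l : ℕ)
    (heq : (ostrowskiDigit a c (l + 1) : ℤ) = partialQuot a (l + 2)) :
    ostrowskiDigit a c l = 0 := by
  by_contra hne
  exact ((greedy_step ha (isRemainder_greedyRem ha hc l)).2.2 hne).ne heq

theorem abs_greedyRem_le (ha : Irrational a)
    (hc : c ∈ Set.Ico (-Int.fract a) (1 - Int.fract a)) (l : ℕ) :
    |greedyRem a c (l + 1)| ≤ gap a (l + 1) := by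
  have h := (isRemainder_greedyRem ha hc l).abs_le_max (prevDiff_mul_prevDiff_succ_neg ha _)
  rwa [abs_prevDiff ha, abs_prevDiff ha, max_eq_left (antitone_gap ha (Nat.le_succ _))] at h

theorem tendsto_greedyRem (ha : Irrational a)
    (hc : c ∈ Set.Ico (-Int.fract a) (1 - Int.fract a)) :
    Filter.Tendsto (greedyRem a c) Filter.atTop (nhds 0) :=
  (Filter.tendsto_add_atTop_iff_nat 1).1 <| squeeze_zero_norm (abs_greedyRem_le ha hc)
    ((Filter.tendsto_add_atTop_iff_nat 1).2 (tendsto_gap ha))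

theorem summable_mul_convDiff (ha : Irrational a)
    (hle : ∀ k, (b k : ℤ) ≤ partialQuot a (k + 1)) :
    Summable fun k => (b k : ℝ) * convDiff a k := by
  have hterm : ∀ k, (b k : ℝ) * gap a (k + 1) ≤ gap a k - gap a (k + 2) := fun k => by
    have : (b k : ℝ) ≤ partialQuot a (k + 1) := mod_cast hle k
    nlinarith [gap_eq_add ha k, gap_pos ha (k + 1)]
  have hsum : ∀ n, ∑ k ∈ Finset.range n, (b k : ℝ) * gap a (k + 1) ≤
      gap a 0 + gap a 1 - gap a n - gap a (n + 1) := fun n => by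
    induction n with
    | zero => simp
    | succ n ih => rw [Finset.sum_range_succ]; linarith [hterm n]
  refine Summable.of_norm (summable_of_sum_range_le (fun _ => norm_nonneg _)
    (c := gap a 0 + gap a 1) fun n => ?_)
  simp only [norm_mul, Real.norm_eq_abs, Nat.abs_cast, abs_convDiff ha]
  linarith [hsum n, gap_pos ha n, gap_pos ha (n + 1)]

theorem hasSum_of_tendsto_ostrowskiRem (ha : Irrational a)
    (hle : ∀ k, (b k : ℤ) ≤ partialQuot a (k + 1))
    (hrem : Filter.Tendsto (ostrowskiRem a b c) Filter.atTop (nhds 0)) :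
    HasSum (fun k => (b k : ℝ) * convDiff a k) c :=
  (summable_mul_convDiff ha hle).hasSum_iff_tendsto_nat.2 <| by
    simpa [ostrowskiRem] using hrem.const_sub c

-- If all digits at even places from `n` on were maximal, then the digits between them would vanish
-- and the defect would be constant at even places, hence zero.
theorem exists_even_digit_lt (ha : Irrational a)
    (hle : ∀ k, (b k : ℤ) ≤ partialQuot a (k + 1))
    (hcarry : ∀ k, (b (k + 1) : ℤ) = partialQuot a (k + 2) → b k = 0)
    (hrem : Filter.Tendsto (ostrowskiRem a b c) Filter.atTop (nhds 0))
    (hpos : ∀ l, Even l → 0 < ostrowskiDefect a b c l) (n : ℕ) :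
    ∃ k, n ≤ k ∧ Even k ∧ (b k : ℤ) < partialQuot a (k + 1) := by
  by_contra! hmax
  have hfull : ∀ k, n ≤ k → Even k → (b k : ℤ) = partialQuot a (k + 1) :=
    fun k hk heven => (hle k).antisymm (hmax k hk heven)
  have hconst : ∀ m, ostrowskiDefect a b c (2 * n + 2 * m) = ostrowskiDefect a b c (2 * n) := by
    intro m
    induction m with
    | zero => rfl
    | succ m ih =>
      have hdigit : (b (2 * n + 2 * m) : ℝ) = partialQuot a (2 * n + 2 * m + 1) :=
        mod_cast hfull (2 * n + 2 * m) (by omega) (by simp [parity_simps])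
      have hnext : b (2 * n + 2 * m + 1) = 0 :=
        hcarry _ (hfull (2 * n + 2 * m + 1 + 1) (by omega) (by simp [parity_simps]))
      rw [← ih, ostrowskiDefect_eq ha (2 * n + 2 * m), hdigit, hnext, mul_add_one, ← add_assoc]
      simp
  have hlim := tendsto_ostrowskiDefect ha hrem (2 * n)
  simp only [hconst] at hlim
  exact (hpos _ (even_two_mul n)).ne (tendsto_nhds_unique hlim tendsto_const_nhds)

theorem isOstrowski_ostrowskiDigit (ha : Irrational a)
    (hc : c ∈ Set.Ico (-Int.fract a) (1 - Int.fract a)) :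
    IsOstrowski a (ostrowskiDigit a c) c := by
  have hle := ostrowskiDigit_le ha hc
  have hrem : Filter.Tendsto (ostrowskiRem a (ostrowskiDigit a c) c) Filter.atTop (nhds 0) := by
    rw [funext (ostrowskiRem_ostrowskiDigit a c)]
    exact tendsto_greedyRem ha hc
  have hfar : ∀ l, -prevDiff a l ≤ ostrowskiRem a (ostrowskiDigit a c) c l ↔ 0 < prevDiff a l := by
    intro l
    rw [ostrowskiRem_ostrowskiDigit]
    cases l with
    | zero =>
      exact (isRemainder_prevDiff_zero_iff.2 hc).far_uncapped
        (prevDiff_mul_prevDiff_succ_neg ha 0)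
    | succ l =>
      exact (isRemainder_greedyRem ha hc l).far_uncapped
        (prevDiff_mul_prevDiff_succ_neg ha (l + 1))
  have hpos : ∀ l, Even l → 0 < ostrowskiDefect a (ostrowskiDigit a c) c l := fun l =>
    (far_iff_ostrowskiDefect ha (ostrowskiDefect_nonneg ha hle hrem) l).1 (hfar l)
  exact
    { zero_lt := ostrowskiDigit_zero_lt ha hc
      le := hle
      carry := ostrowskiDigit_carry ha hc
      infinite := exists_even_digit_lt ha hle (ostrowskiDigit_carry ha hc) hrem hpos
      hasSum := hasSum_of_tendsto_ostrowskiRem ha hle hrem }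

theorem exists_isOstrowski_of_even_eq_zero (ha : Irrational a)
    (hle : ∀ k, (b k : ℤ) ≤ partialQuot a (k + 1)) (heven : ∀ k, Even k → b k = 0) :
    ∃ c, IsOstrowski a b c := by
  have hlt : ∀ k, Even k → (b k : ℤ) < partialQuot a (k + 1) := fun k hk => by
    have := one_le_partialQuot_succ ha k
    rw [heven k hk]; omega
  refine ⟨_, hlt 0 Even.zero, hle, fun k hmax => heven k ?_, fun n => ?_,
    (summable_mul_convDiff ha hle).hasSum⟩
  · by_contra hodd
    exact (hlt (k + 1) (Nat.not_even_iff_odd.1 hodd).add_one).ne hmax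
  · exact ⟨2 * n, by omega, even_two_mul n, hlt _ (even_two_mul n)⟩

end Existence

section Truncation

variable {a c : ℝ} {b : ℕ → ℕ}

/-- The natural number `∑_{k < l} b_{k+1} q_k` with the first `l` digits of `b`. -/
noncomputable def ostrowskiTrunc (a : ℝ) (b : ℕ → ℕ) (l : ℕ) : ℕ :=
  ∑ k ∈ Finset.range l, b k * convDen a k

/-- `n` is the number `∑_{k ≤ j} b_{k+1} q_k` with the digits of `c` up to `β_j`, characterised
without digits: up to an integer, `c` exceeds `n a` by a remainder after `β_j`. -/
def IsTruncation (a : ℝ) (j n : ℕ) (c : ℝ) : Prop :=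
  n < convDen a (j + 1) ∧ ∃ P : ℤ,
    IsRemainder (convDiff a j) (convDiff a (j + 1)) (convDen a j ≤ n) (c - (n * a - P))

theorem ostrowskiTrunc_succ (a : ℝ) (b : ℕ → ℕ) (l : ℕ) :
    ostrowskiTrunc a b (l + 1) = ostrowskiTrunc a b l + b l * convDen a l :=
  Finset.sum_range_succ ..

theorem ostrowskiTrunc_lt (ha : Irrational a) (h : IsOstrowski a b c) (l : ℕ) :
    ostrowskiTrunc a b l < convDen a l := by
  induction l using Nat.twoStepInduction with
  | zero => simp [ostrowskiTrunc, convDen_pos]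
  | one =>
    have hlt := h.zero_lt
    rw [← convDen_one ha] at hlt
    simpa [ostrowskiTrunc, convDen_zero] using hlt
  | more l ih ih' =>
    have hrec := (convNum_convDen_add_two ha l).2
    rcases (h.le (l + 1)).eq_or_lt with hmax | hlt
    · rw [ostrowskiTrunc_succ, ostrowskiTrunc_succ, h.carry l hmax]
      zify at ih ⊢
      rw [hmax, hrec]
      linarith
    · rw [ostrowskiTrunc_succ]
      zify at ih' ⊢
      nlinarith [Int.natCast_nonneg (convDen a l)]

theorem ostrowskiTrunc_succ_div (ha : Irrational a) (h : IsOstrowski a b c) (l : ℕ) :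
    ostrowskiTrunc a b (l + 1) / convDen a l = b l := by
  rw [ostrowskiTrunc_succ, Nat.add_mul_div_right _ _ (convDen_pos a l),
    Nat.div_eq_of_lt (ostrowskiTrunc_lt ha h l), zero_add]

theorem exists_ostrowskiRem_eq (a : ℝ) (b : ℕ → ℕ) (c : ℝ) (l : ℕ) :
    ∃ P : ℤ, ostrowskiRem a b c l = c - (ostrowskiTrunc a b l * a - P) := by
  refine ⟨∑ k ∈ Finset.range l, b k * convNum a k, ?_⟩
  simp only [ostrowskiRem, ostrowskiTrunc, convDiff]
  push_cast
  rw [Finset.sum_mul, ← Finset.sum_sub_distrib]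
  congr 1
  exact Finset.sum_congr rfl fun k _ => by ring

theorem IsOstrowski.isTruncation (ha : Irrational a) (h : IsOstrowski a b c) (j : ℕ) :
    IsTruncation a j (ostrowskiTrunc a b (j + 1)) c := by
  obtain ⟨P, hP⟩ := exists_ostrowskiRem_eq a b c (j + 1)
  have hcapped : convDen a j ≤ ostrowskiTrunc a b (j + 1) ↔ b j ≠ 0 := by
    rw [← ostrowskiTrunc_succ_div ha h j, Ne, Nat.div_eq_zero_iff_lt (convDen_pos a j), not_lt]
  refine ⟨ostrowskiTrunc_lt ha h _, P, ?_⟩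
  rw [← hP, hcapped]
  exact h.isRemainder_succ ha j

theorem IsTruncation.unique (ha : Irrational a) {j n n' : ℕ} (h : IsTruncation a j n c)
    (h' : IsTruncation a j n' c) : n = n' := by
  wlog hle : n ≤ n' generalizing n n'
  · exact (this h' h (le_of_not_ge hle)).symm
  obtain ⟨-, P, hP⟩ := h
  obtain ⟨hlt', P', hP'⟩ := h'
  have hclose : |((n' - n : ℤ) : ℝ) * a - (P' - P : ℤ)| < gap a (j + 1) + gap a (j + 2) := by
    rw [← abs_convDiff ha, ← abs_convDiff ha]
    convert hP.abs_sub_lt hP' (prevDiff_mul_prevDiff_succ_neg ha (j + 1)) using 2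
    push_cast; ring
  obtain ⟨u, hu, hn, hPu⟩ := exists_eq_mul_conv_of_abs_lt ha (m := n' - n) (by
    rw [abs_of_nonneg (by omega)]; omega) hclose
  have hden := convDen_pos a j
  obtain rfl | rfl : u = 0 ∨ u = 1 := by
    have : 0 ≤ u := by by_contra; nlinarith
    rw [abs_le] at hu
    omega
  · omega
  · have hne : convDiff a j ≠ 0 := abs_pos.1 (abs_convDiff ha j ▸ gap_pos ha (j + 1))
    have hsub : c - (n' * a - P') = c - (n * a - P) - convDiff a j := by
      obtain rfl : n' = n + convDen a j := by omega
      obtain rfl : P' = P + convNum a j := by omega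
      rw [convDiff]; push_cast; ring
    exact absurd (hsub ▸ hP') (hP.not_capped_sub hne (by omega))

theorem IsOstrowski.eq (ha : Irrational a) {b' : ℕ → ℕ} (h : IsOstrowski a b c)
    (h' : IsOstrowski a b' c) : b = b' := by
  funext l
  rw [← ostrowskiTrunc_succ_div ha h, ← ostrowskiTrunc_succ_div ha h',
    (h.isTruncation ha l).unique ha (h'.isTruncation ha l)]

theorem IsOstrowski.mem_Ico (ha : Irrational a) (h : IsOstrowski a b c) :
    c ∈ Set.Ico (-Int.fract a) (1 - Int.fract a) :=
  isRemainder_prevDiff_zero_iff.1 (h.isRemainder_zero ha)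

theorem existsUnique_isOstrowski (ha : Irrational a)
    (hc : c ∈ Set.Ico (-Int.fract a) (1 - Int.fract a)) : ∃! b, IsOstrowski a b c :=
  ⟨_, isOstrowski_ostrowskiDigit ha hc, fun _ h => h.eq ha (isOstrowski_ostrowskiDigit ha hc)⟩

theorem IsOstrowski.digit_eq_iff (ha : Irrational a) (h : IsOstrowski a b c) {l i : ℕ} :
    b l = i ↔ ∃ n, IsTruncation a l n c ∧ n / convDen a l = i := by
  rw [← ostrowskiTrunc_succ_div ha h l]
  exact ⟨fun hi => ⟨_, h.isTruncation ha l, hi⟩,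
    fun ⟨n, hn, hi⟩ => by rw [(h.isTruncation ha l).unique ha hn, hi]⟩

end Truncation

/-! ### Definability -/

section DefinablePred

variable {L : FirstOrder.Language} {M : Type*} [L.Structure M] {α : Type*}

/-- A predicate on families of elements of `M` is definable without parameters. Spelling the
definable set as a predicate lets definability be read off a formula connective by connective;
`Option α` serves as the index type extended by one bound variable. -/
def DefinablePred (L : FirstOrder.Language) {M : Type*} [L.Structure M] {α : Type*}
    (P : (α → M) → Prop) : Prop :=
  (∅ : Set M).Definable L {v | P v}

namespace DefinablePred

variable {P Q : (α → M) → Prop} {f g : (α → M) → M}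

theorem congr (hP : DefinablePred L P) (h : ∀ v, Q v ↔ P v) : DefinablePred L Q := by
  rwa [funext fun v => propext (h v)]

theorem and (hP : DefinablePred L P) (hQ : DefinablePred L Q) :
    DefinablePred L fun v => P v ∧ Q v :=
  hP.inter hQ

theorem or (hP : DefinablePred L P) (hQ : DefinablePred L Q) :
    DefinablePred L fun v => P v ∨ Q v :=
  hP.union hQ

theorem not (hP : DefinablePred L P) : DefinablePred L fun v => ¬P v :=
  hP.compl

theorem imp (hP : DefinablePred L P) (hQ : DefinablePred L Q) :
    DefinablePred L fun v => P v → Q v :=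
  (hP.not.or hQ).congr fun _ => imp_iff_not_or

theorem iff (hP : DefinablePred L P) (hQ : DefinablePred L Q) :
    DefinablePred L fun v => P v ↔ Q v :=
  ((hP.imp hQ).and (hQ.imp hP)).congr fun _ => iff_iff_implies_and_implies

theorem reindex {β : Type*} (hP : DefinablePred L P) (e : α → β) :
    DefinablePred L fun v : β → M => P fun i => v (e i) :=
  hP.preimage_comp e

theorem ex {P : (α → M) → M → Prop}
    (hP : DefinablePred L fun w : Option α → M => P (fun i => w (some i)) (w none)) :
    DefinablePred L fun v => ∃ x, P v x := by
  have hsum := (hP.reindex fun o : Option α => o.elim (Sum.inr ()) Sum.inl).exists_of_finite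
  refine DefinablePred.congr hsum fun v => ?_
  exact ⟨fun ⟨x, hx⟩ => ⟨fun _ => x, hx⟩, fun ⟨u, hu⟩ => ⟨u (), hu⟩⟩

theorem all {P : (α → M) → M → Prop}
    (hP : DefinablePred L fun w : Option α → M => P (fun i => w (some i)) (w none)) :
    DefinablePred L fun v => ∀ x, P v x :=
  (DefinablePred.ex (P := fun v x => ¬P v x) hP.not).not.congr fun _ => not_exists_not.symm

theorem eq (hf : (∅ : Set M).DefinableFun L f) (hg : (∅ : Set M).DefinableFun L g) :
    DefinablePred L fun v => f v = g v :=
  hf.ofPred_eq hg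

theorem mem₁ {S : Set M} (hS : (∅ : Set M).Definable₁ L S) (hf : (∅ : Set M).DefinableFun L f) :
    DefinablePred L fun v => f v ∈ S :=
  Set.Definable.preimage_map (F := fun v => ![f v]) (fun i => by fin_cases i; exact hf) hS

theorem mem₂ {S : Set (M × M)} (hS : (∅ : Set M).Definable₂ L S)
    (hf : (∅ : Set M).DefinableFun L f) (hg : (∅ : Set M).DefinableFun L g) :
    DefinablePred L fun v => (f v, g v) ∈ S :=
  Set.Definable.preimage_map (F := fun v => ![f v, g v])
    (fun i => by fin_cases i; exacts [hf, hg]) hS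

theorem definableFun (h : DefinablePred L fun w : Option α → M => w none = f fun i => w (some i)) :
    (∅ : Set M).DefinableFun L f :=
  h.congr fun _ => eq_comm

end DefinablePred

theorem definable₁_relMap (R : L.Relations 1) :
    (∅ : Set M).Definable₁ L {x | FirstOrder.Language.Structure.RelMap R ![x]} :=
  Set.empty_definable_iff.2 ⟨R.formula₁ (.var 0), by
    ext v; simp [FirstOrder.Language.Formula.realize_rel₁]⟩

theorem definable₂_relMap (R : L.Relations 2) :
    (∅ : Set M).Definable₂ L {z | FirstOrder.Language.Structure.RelMap R ![z.1, z.2]} :=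
  Set.empty_definable_iff.2 ⟨R.formula₂ (.var 0) (.var 1), by
    ext v; simp [FirstOrder.Language.Formula.realize_rel₂]⟩

theorem definableFun_comp_some {f : (α → M) → M} (hf : (∅ : Set M).DefinableFun L f) :
    (∅ : Set M).DefinableFun L fun w : Option α → M => f fun i => w (some i) :=
  DefinablePred.reindex (P := fun w => f (fun i => w (some i)) = w none) hf
    fun o => o.elim none fun i => some (some i)

end DefinablePred

section DefinesLattice

/-- The `L`-structure on `ℝ` defines without parameters the order, the addition and the groups `ℤ`
and `ℤa`. What is proved from this alone holds in `(ℝ, <, +, ℤ, ℤa)`, and also in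
`(ℝ, <, +, ℤ, ℤa₀)` whenever `a` is a rational multiple of `a₀`. -/
structure DefinesLattice (L : FirstOrder.Language) [L.Structure ℝ] (a : ℝ) : Prop where
  definable_lt : (∅ : Set ℝ).Definable₂ L {z | z.1 < z.2}
  definableFun_add : (∅ : Set ℝ).DefinableFun L fun v : Fin 2 → ℝ => v 0 + v 1
  zmultiples_one : (∅ : Set ℝ).Definable₁ L (AddSubgroup.zmultiples (1 : ℝ) : Set ℝ)
  zmultiples_self : (∅ : Set ℝ).Definable₁ L (AddSubgroup.zmultiples a : Set ℝ)

namespace DefinesLattice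

open DefinablePred

variable {L : FirstOrder.Language} [L.Structure ℝ] {a u : ℝ} {α : Type*} {f g : (α → ℝ) → ℝ}

theorem lt (h : DefinesLattice L a) (hf : (∅ : Set ℝ).DefinableFun L f)
    (hg : (∅ : Set ℝ).DefinableFun L g) : DefinablePred L fun v => f v < g v :=
  mem₂ h.definable_lt hf hg

theorem le (h : DefinesLattice L a) (hf : (∅ : Set ℝ).DefinableFun L f)
    (hg : (∅ : Set ℝ).DefinableFun L g) : DefinablePred L fun v => f v ≤ g v :=
  (h.lt hg hf).not.congr fun _ => not_lt.symm

theorem add (h : DefinesLattice L a) (hf : (∅ : Set ℝ).DefinableFun L f)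
    (hg : (∅ : Set ℝ).DefinableFun L g) : (∅ : Set ℝ).DefinableFun L fun v => f v + g v :=
  h.definableFun_add.comp (g := fun v => ![f v, g v]) fun i => by fin_cases i; exacts [hf, hg]

theorem zero (h : DefinesLattice L a) : (∅ : Set ℝ).DefinableFun L fun _ : α → ℝ => 0 :=
  ((eq (h.add (.proj L) (.proj L (i := none))) (.proj L)).congr
    fun _ => add_eq_right.symm).definableFun

theorem sub (h : DefinesLattice L a) (hf : (∅ : Set ℝ).DefinableFun L f)
    (hg : (∅ : Set ℝ).DefinableFun L g) : (∅ : Set ℝ).DefinableFun L fun v => f v - g v :=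
  ((eq (h.add (.proj L) (definableFun_comp_some hg)) (definableFun_comp_some hf)).congr
    fun _ => eq_sub_iff_add_eq).definableFun

theorem neg (h : DefinesLattice L a) (hf : (∅ : Set ℝ).DefinableFun L f) :
    (∅ : Set ℝ).DefinableFun L fun v => -f v := by
  simpa only [zero_sub] using h.sub h.zero hf

theorem abs (h : DefinesLattice L a) (hf : (∅ : Set ℝ).DefinableFun L f) :
    (∅ : Set ℝ).DefinableFun L fun v => |f v| := by
  classical
  convert! Set.DefinableFun.ite (h.le h.zero hf) hf (h.neg hf) using 2 with v
  split_ifs with hv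
  exacts [abs_of_nonneg hv, abs_of_neg (not_le.1 hv)]

theorem nsmul (h : DefinesLattice L a) (n : ℕ) (hf : (∅ : Set ℝ).DefinableFun L f) :
    (∅ : Set ℝ).DefinableFun L fun v => n • f v := by
  induction n with
  | zero => simpa only [zero_smul] using h.zero
  | succ n ih => simpa only [succ_nsmul] using h.add ih hf

theorem zsmul (h : DefinesLattice L a) (n : ℤ) (hf : (∅ : Set ℝ).DefinableFun L f) :
    (∅ : Set ℝ).DefinableFun L fun v => n • f v := by
  obtain ⟨m, rfl | rfl⟩ := n.eq_nat_or_neg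
  · simpa only [natCast_zsmul] using h.nsmul m hf
  · simpa only [neg_smul, natCast_zsmul] using h.neg (h.nsmul m hf)

theorem isLeast (h : DefinesLattice L a) {P : (α → ℝ) → ℝ → Prop}
    (hP : DefinablePred L fun w : Option α → ℝ => P (fun i => w (some i)) (w none))
    (hf : (∅ : Set ℝ).DefinableFun L f)
    (hPf : DefinablePred L fun v => P v (f v)) :
    DefinablePred L fun v => IsLeast {x | P v x} (f v) :=
  hPf.and (all (hP.imp (h.le (definableFun_comp_some hf) (.proj L))))

theorem const_of_zmultiples (h : DefinesLattice L a) (hu : 0 < u)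
    (hmul : (∅ : Set ℝ).Definable₁ L (AddSubgroup.zmultiples u : Set ℝ)) :
    (∅ : Set ℝ).DefinableFun L fun _ : α → ℝ => u := by
  refine ((h.isLeast (P := fun _ x => x ∈ (AddSubgroup.zmultiples u : Set ℝ) ∧ 0 < x)
    ((mem₁ hmul (.proj L)).and (h.lt h.zero (.proj L))) (.proj L (i := none))
    ((mem₁ hmul (.proj L)).and (h.lt h.zero (.proj L)))).congr fun w => ?_).definableFun
  simp only [SetLike.mem_coe, AddSubgroup.zmultiples_eq_closure,
    AddSubgroup.isLeast_of_closure_iff_eq_abs, abs_of_pos hu, iff_self_and]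
  exact fun hw => hw ▸ hu

theorem one (h : DefinesLattice L a) : (∅ : Set ℝ).DefinableFun L fun _ : α → ℝ => 1 :=
  h.const_of_zmultiples one_pos h.zmultiples_one

theorem self (h : DefinesLattice L a) (ha : 0 < a) :
    (∅ : Set ℝ).DefinableFun L fun _ : α → ℝ => a :=
  h.const_of_zmultiples ha h.zmultiples_self

theorem exists_nat_mul (h : DefinesLattice L a) (hu : 0 < u)
    (hmul : (∅ : Set ℝ).Definable₁ L (AddSubgroup.zmultiples u : Set ℝ))
    (hf : (∅ : Set ℝ).DefinableFun L f) : DefinablePred L fun v => ∃ n : ℕ, f v = n * u := by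
  refine ((mem₁ hmul hf).and (h.le h.zero hf)).congr fun v => ?_
  simp only [SetLike.mem_coe, AddSubgroup.mem_zmultiples_iff, zsmul_eq_mul]
  constructor
  · rintro ⟨n, hn⟩
    exact ⟨⟨n, by simp [hn]⟩, by rw [hn]; positivity⟩
  · rintro ⟨⟨n, hn⟩, hnonneg⟩
    have hn0 : 0 ≤ n := by exact_mod_cast nonneg_of_mul_nonneg_left (hn ▸ hnonneg) hu
    exact ⟨n.toNat, by rw [← hn, ← Int.cast_natCast, Int.toNat_of_nonneg hn0]⟩

theorem isRemainder (h : DefinesLattice L a) {β β' r : (α → ℝ) → ℝ} {P : (α → ℝ) → Prop}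
    (hβ : (∅ : Set ℝ).DefinableFun L β) (hβ' : (∅ : Set ℝ).DefinableFun L β')
    (hP : DefinablePred L P) (hr : (∅ : Set ℝ).DefinableFun L r) :
    DefinablePred L fun v => IsRemainder (β v) (β' v) (P v) (r v) :=
  (((h.le (h.neg hβ') hr).iff (h.lt hβ h.zero)).and
    ((hP.not.imp ((h.le (h.neg hβ) hr).iff (h.lt h.zero hβ))).and
      (hP.imp ((h.le (h.neg (h.add hβ hβ')) hr).iff (h.lt h.zero hβ))))).congr
    fun _ => ⟨fun hrem => ⟨hrem.near, hrem.far, hrem.far_of_capped⟩,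
      fun ⟨hnear, hfar, hcapped⟩ => ⟨hnear, hfar, hcapped⟩⟩

theorem of_mul_eq (h : DefinesLattice L a) {a' : ℝ} {m n : ℤ} (hm : m ≠ 0)
    (hmul : m * a' = n * a) : DefinesLattice L a' where
  definable_lt := h.definable_lt
  definableFun_add := h.definableFun_add
  zmultiples_one := h.zmultiples_one
  zmultiples_self := by
    refine (ex (P := fun v z => z ∈ (AddSubgroup.zmultiples a : Set ℝ) ∧ m • v 0 = n • z)
      ((mem₁ h.zmultiples_self (.proj L)).and
        (eq (h.zsmul m (.proj L)) (h.zsmul n (.proj L))))).congr fun v => ?_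
    have hm' : (m : ℝ) ≠ 0 := mod_cast hm
    simp only [SetLike.mem_coe, AddSubgroup.mem_zmultiples_iff, zsmul_eq_mul,
      exists_exists_eq_and]
    refine exists_congr fun k => ?_
    rw [mul_left_comm, ← hmul, mul_left_comm, mul_right_inj' hm', eq_comm]

end DefinesLattice

theorem definesLattice_structR (a : ℝ) : @DefinesLattice latticeLang (structR a) a :=
  letI := structR a
  { definable_lt := definable₂_relMap (L := latticeLang) LatticeRel.lt
    definableFun_add := .fun_symbol (L := latticeLang) LatticeFunc.add
    zmultiples_one := by
      convert! definable₁_relMap (L := latticeLang) LatticeRel.isInt using 1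
      ext x
      simp [AddSubgroup.mem_zmultiples_iff, FirstOrder.Language.Structure.RelMap, eq_comm]
    zmultiples_self := by
      convert! definable₁_relMap (L := latticeLang) LatticeRel.isIntMul using 1
      ext x
      simp [AddSubgroup.mem_zmultiples_iff, FirstOrder.Language.Structure.RelMap, eq_comm] }

end DefinesLattice

section Definability

open DefinablePred

variable {L : FirstOrder.Language} [L.Structure ℝ] {a : ℝ}

theorem mem_bestApprox_iff_forall (hpos : 0 < a) {x y : ℝ} : (x, y) ∈ bestApprox a ↔
    (∃ p : ℕ, x = p * 1) ∧ (0 < y ∧ ∃ q : ℕ, y = q * a) ∧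
      ∀ x' y' : ℝ, (∃ p : ℕ, x' = p * 1) → (0 < y' ∧ ∃ q : ℕ, y' = q * a) → y' ≤ y →
        ¬(x = x' ∧ y = y') → |y - x| < |y' - x'| := by
  simp only [mul_one]
  constructor
  · rintro ⟨p, q, hq, hz, hbest⟩
    obtain ⟨rfl, rfl⟩ := Prod.mk.inj hz
    refine ⟨⟨p, rfl⟩, ⟨by positivity, q, rfl⟩, ?_⟩
    rintro _ _ ⟨p', rfl⟩ ⟨hq', q', rfl⟩ hle hne
    refine hbest p' q' (by exact_mod_cast pos_of_mul_pos_left hq' hpos.le)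
      (by exact_mod_cast le_of_mul_le_mul_right hle hpos) fun h => hne ?_
    obtain ⟨rfl, rfl⟩ := Prod.mk.inj h
    exact ⟨rfl, rfl⟩
  · rintro ⟨⟨p, rfl⟩, ⟨hq, q, rfl⟩, hbest⟩
    refine ⟨p, q, by exact_mod_cast pos_of_mul_pos_left hq hpos.le, rfl,
      fun p' q' hq' hle hne => hbest _ _ ⟨p', rfl⟩ ⟨by positivity, q', rfl⟩
        (by gcongr) fun ⟨hp, hq⟩ => hne ?_⟩
    rw [Nat.cast_inj.1 hp, Nat.cast_inj.1 (mul_right_cancel₀ hpos.ne' hq)]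

namespace DefinesLattice

theorem definable_bestApprox (h : DefinesLattice L a) (hpos : 0 < a) :
    (∅ : Set ℝ).Definable₂ L (bestApprox a) := by
  refine DefinablePred.congr ?_ fun v => mem_bestApprox_iff_forall hpos
  have isNat : ∀ {β : Type} {f : (β → ℝ) → ℝ}, (∅ : Set ℝ).DefinableFun L f →
      DefinablePred L fun v => ∃ p : ℕ, f v = p * 1 :=
    h.exists_nat_mul one_pos h.zmultiples_one
  have isPosMul : ∀ {β : Type} {f : (β → ℝ) → ℝ}, (∅ : Set ℝ).DefinableFun L f →
      DefinablePred L fun v => 0 < f v ∧ ∃ q : ℕ, f v = q * a := fun hf =>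
    (h.lt h.zero hf).and (h.exists_nat_mul hpos h.zmultiples_self hf)
  exact (isNat (.proj L)).and ((isPosMul (.proj L)).and (all (all ((isNat (.proj L)).imp
    ((isPosMul (.proj L)).imp ((h.le (.proj L) (.proj L)).imp
      (((eq (.proj L) (.proj L)).and (eq (.proj L) (.proj L))).not.imp
        (h.lt (h.abs (h.sub (.proj L) (.proj L))) (h.abs (h.sub (.proj L) (.proj L)))))))))))

theorem definable_bestDen (h : DefinesLattice L a) (hpos : 0 < a) :
    (∅ : Set ℝ).Definable₁ L (bestDen a) := by
  refine (ex (P := fun v p => (p, v 0) ∈ bestApprox a)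
    (mem₂ (h.definable_bestApprox hpos) (.proj L) (.proj L))).congr fun v => ?_
  simp [bestDen]

theorem definable_Ico (h : DefinesLattice L a) (hpos : 0 < a) :
    (∅ : Set ℝ).Definable₁ L (Set.Ico (1 - a) (2 - a)) := by
  rw [← one_add_one_eq_two]
  exact (h.le (h.sub h.one (h.self hpos)) (.proj L)).and
    (h.lt (.proj L) (h.sub (h.add h.one h.one) (h.self hpos)))

end DefinesLattice

theorem mem_oddDen_iff (ha : Irrational a) (hpos : 0 < a) (hquot : partialQuot a 1 = 1) {x : ℝ} :
    x ∈ oddDen a ↔ ∃ p, (p, x) ∈ bestApprox a ∧ x < p := by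
  have hlt : ∀ k, (convDen a k : ℝ) * a < convNum a k ↔ Odd k := fun k => by
    rw [← sub_neg, ← convDiff, ← prevDiff_succ, prevDiff_neg_iff ha, Nat.even_add_one,
      Nat.not_even_iff_odd]
  simp only [mem_bestApprox_iff ha hpos hquot, Prod.mk.injEq]
  constructor
  · rintro ⟨_, ⟨k, rfl⟩, rfl⟩
    exact ⟨_, ⟨2 * k, rfl, rfl⟩, (hlt _).2 ⟨k, rfl⟩⟩
  · rintro ⟨_, ⟨k, rfl, rfl⟩, hk⟩
    exact ⟨k + 1, (hlt _).1 hk, rfl⟩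

theorem DefinesLattice.definable_oddDen (h : DefinesLattice L a) (ha : Irrational a) (hpos : 0 < a)
    (hquot : partialQuot a 1 = 1) : (∅ : Set ℝ).Definable₁ L (oddDen a) :=
  (ex (P := fun v p => (p, v 0) ∈ bestApprox a ∧ v 0 < p)
    ((mem₂ (h.definable_bestApprox hpos) (.proj L) (.proj L)).and
      (h.lt (.proj L) (.proj L)))).congr fun _ => mem_oddDen_iff ha hpos hquot

theorem floor_eq_one (hlow : 1 ≤ a) (hhigh : a < 2) : ⌊a⌋ = 1 := by
  rw [Int.floor_eq_iff]
  norm_num [hlow, hhigh]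

theorem fract_eq_sub_one (hlow : 1 ≤ a) (hhigh : a < 2) : Int.fract a = a - 1 := by
  rw [Int.fract, floor_eq_one hlow hhigh, Int.cast_one]

theorem partialQuot_one (hlow : 3 / 2 < a) (hhigh : a < 2) : partialQuot a 1 = 1 := by
  change ⌊(Int.fract a)⁻¹⌋ = 1
  rw [fract_eq_sub_one (by linarith) hhigh]
  exact floor_eq_one ((one_le_inv₀ (by linarith)).2 (by linarith))
    ((inv_lt_comm₀ (by linarith) two_pos).2 (by linarith))

theorem Ico_one_sub_two_sub (hlow : 1 ≤ a) (hhigh : a < 2) :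
    Set.Ico (1 - a) (2 - a) = Set.Ico (-Int.fract a) (1 - Int.fract a) := by
  rw [fract_eq_sub_one hlow hhigh]
  ring_nf

theorem existsUnique_isOstrowski_of_mem_Ico (ha : Irrational a) (hlow : 1 ≤ a) (hhigh : a < 2)
    {c : ℝ} (hc : c ∈ Set.Ico (1 - a) (2 - a)) : ∃! b, IsOstrowski a b c :=
  existsUnique_isOstrowski ha (Ico_one_sub_two_sub hlow hhigh ▸ hc)

theorem consecutive_bestApprox_iff (ha : Irrational a) (hpos : 0 < a)
    (hquot : partialQuot a 1 = 1) {p x p' x' : ℝ} :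
    ((p, x) ∈ bestApprox a ∧ (p', x') ∈ bestApprox a ∧ IsLeast {w | w ∈ bestDen a ∧ x < w} x') ↔
      ∃ k, (p, x) = ((convNum a (k + 1) : ℝ), (convDen a (k + 1) : ℝ) * a) ∧
        (p', x') = ((convNum a (k + 2) : ℝ), (convDen a (k + 2) : ℝ) * a) := by
  have hmono := strictMono_convDen_succ_mul ha hpos
  simp only [mem_bestApprox_iff ha hpos hquot, bestDen_eq_range ha hpos hquot, Prod.mk.injEq]
  constructor
  · rintro ⟨⟨k, rfl, rfl⟩, ⟨k', rfl, rfl⟩, hleast⟩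
    have hk' : k' = k + 1 :=
      hmono.injective (hleast.unique (isLeast_range_gt_of_strictMono hmono k))
    exact ⟨k, ⟨rfl, rfl⟩, by rw [hk'], by rw [hk']⟩
  · rintro ⟨k, ⟨rfl, rfl⟩, rfl, rfl⟩
    exact ⟨⟨k, rfl, rfl⟩, ⟨k + 1, rfl, rfl⟩, isLeast_range_gt_of_strictMono hmono k⟩

/-- For consecutive best approximations `(p, x) = (p_l, q_l a)` and
`(p', x') = (p_{l+1}, q_{l+1} a)`, this expresses that `i` is the digit of `c` at `β_l`: the witness
`y` is `n a`, where `n = ∑_{k ≤ l} b_{k+1} q_k`, and the digit is the quotient of `y` by `x`. -/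
def HasDigit (a : ℝ) (i : ℕ) (p x p' x' c : ℝ) : Prop :=
  ∃ y z : ℝ, (∃ n : ℕ, y = n * a) ∧ z ∈ (AddSubgroup.zmultiples (1 : ℝ) : Set ℝ) ∧ y < x' ∧
    IsRemainder (x - p) (x' - p') (x ≤ y) (c - (y - z)) ∧ i • x ≤ y ∧ y < (i + 1) • x

theorem IsOstrowski.hasDigit_iff {b : ℕ → ℕ} {c : ℝ} (ha : Irrational a) (hpos : 0 < a)
    (hb : IsOstrowski a b c) {l i : ℕ} :
    HasDigit a i (convNum a l) (convDen a l * a) (convNum a (l + 1)) (convDen a (l + 1) * a) c ↔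
      b l = i := by
  have hdiv : ∀ n, n / convDen a l = i ↔
      i • ((convDen a l : ℝ) * a) ≤ n * a ∧ n * a < (i + 1) • ((convDen a l : ℝ) * a) := by
    intro n
    rw [Nat.div_eq_iff (convDen_pos a l),
      Nat.le_sub_one_iff_lt (Nat.add_pos_right _ (convDen_pos a l)), ← Nat.succ_mul,
      nsmul_eq_mul, nsmul_eq_mul, ← mul_assoc, ← mul_assoc, mul_le_mul_iff_left₀ hpos,
      mul_lt_mul_iff_left₀ hpos]
    norm_cast
  have hzmul : ∀ z, z ∈ (AddSubgroup.zmultiples (1 : ℝ) : Set ℝ) ↔ ∃ P : ℤ, z = P := fun z => by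
    simp [AddSubgroup.mem_zmultiples_iff, eq_comm]
  rw [hb.digit_eq_iff ha]
  simp only [IsTruncation, hdiv, HasDigit, hzmul]
  constructor
  · rintro ⟨_, _, ⟨n, rfl⟩, ⟨P, rfl⟩, hlt, hrem, hquot⟩
    rw [mul_le_mul_iff_left₀ hpos, Nat.cast_le] at hrem
    rw [mul_lt_mul_iff_left₀ hpos, Nat.cast_lt] at hlt
    exact ⟨n, ⟨hlt, P, hrem⟩, hquot⟩
  · rintro ⟨n, ⟨hlt, P, hrem⟩, hquot⟩
    rw [← Nat.cast_le (α := ℝ), ← mul_le_mul_iff_left₀ hpos] at hrem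
    rw [← Nat.cast_lt (α := ℝ), ← mul_lt_mul_iff_left₀ hpos] at hlt
    exact ⟨_, _, ⟨n, rfl⟩, ⟨P, rfl⟩, hlt, hrem, hquot⟩

theorem mem_digitRel_iff (ha : Irrational a) (hlow : 3 / 2 < a) (hhigh : a < 2) {i : ℕ} {x c : ℝ} :
    (x, c) ∈ digitRel a i ↔ c ∈ Set.Ico (1 - a) (2 - a) ∧ ∃ p p' x' : ℝ,
      ((p, x) ∈ bestApprox a ∧ (p', x') ∈ bestApprox a ∧
        IsLeast {w | w ∈ bestDen a ∧ x < w} x') ∧ HasDigit a i p x p' x' c := by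
  have hpos : 0 < a := by linarith
  refine and_congr_right fun hc => ?_
  simp only [consecutive_bestApprox_iff ha hpos (partialQuot_one hlow hhigh), Prod.mk.injEq]
  constructor
  · rintro ⟨l, b, hl, rfl, hb, hdigit⟩
    obtain ⟨k, rfl⟩ := Nat.exists_eq_add_of_le' hl
    exact ⟨_, _, _, ⟨k, ⟨rfl, rfl⟩, rfl, rfl⟩, (hb.hasDigit_iff ha hpos).2 hdigit⟩
  · rintro ⟨_, _, _, ⟨k, ⟨rfl, rfl⟩, rfl, rfl⟩, hdigit⟩
    obtain ⟨b, hb, -⟩ := existsUnique_isOstrowski_of_mem_Ico ha (by linarith) hhigh hc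
    exact ⟨k + 1, b, k.succ_pos, rfl, hb, (hb.hasDigit_iff ha hpos).1 hdigit⟩

theorem DefinesLattice.hasDigit (h : DefinesLattice L a) (hpos : 0 < a) (i : ℕ) {α : Type}
    {p x p' x' c : (α → ℝ) → ℝ} (hp : (∅ : Set ℝ).DefinableFun L p)
    (hx : (∅ : Set ℝ).DefinableFun L x) (hp' : (∅ : Set ℝ).DefinableFun L p')
    (hx' : (∅ : Set ℝ).DefinableFun L x') (hc : (∅ : Set ℝ).DefinableFun L c) :
    DefinablePred L fun v => HasDigit a i (p v) (x v) (p' v) (x' v) (c v) := by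
  have lift : ∀ {f : (α → ℝ) → ℝ}, (∅ : Set ℝ).DefinableFun L f → (∅ : Set ℝ).DefinableFun L
      fun w : Option (Option α) → ℝ => f fun j => w (some (some j)) := fun hf =>
    definableFun_comp_some (definableFun_comp_some hf)
  refine ex (P := fun v y => ∃ z, _) (ex (P := fun w z => (∃ n : ℕ, w none = n * a) ∧ _) ?_)
  exact (h.exists_nat_mul hpos h.zmultiples_self (.proj L)).and
    ((mem₁ h.zmultiples_one (.proj L)).and ((h.lt (.proj L) (lift hx')).and
      ((h.isRemainder (h.sub (lift hx) (lift hp)) (h.sub (lift hx') (lift hp'))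
        (h.le (lift hx) (.proj L)) (h.sub (lift hc) (h.sub (.proj L) (.proj L)))).and
      ((h.le (h.nsmul i (lift hx)) (.proj L)).and
        (h.lt (.proj L) (h.nsmul (i + 1) (lift hx)))))))

theorem DefinesLattice.definable_digitRel (h : DefinesLattice L a) (ha : Irrational a)
    (hlow : 3 / 2 < a) (hhigh : a < 2) (i : ℕ) : (∅ : Set ℝ).Definable₂ L (digitRel a i) := by
  have hpos : 0 < a := by linarith
  refine DefinablePred.congr ?_ fun v => mem_digitRel_iff ha hlow hhigh
  have hbest := h.definable_bestApprox hpos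
  have hden := h.definable_bestDen hpos
  exact (mem₁ (h.definable_Ico hpos) (.proj L)).and (ex (ex (ex
    (((mem₂ hbest (.proj L) (.proj L)).and ((mem₂ hbest (.proj L) (.proj L)).and
      (h.isLeast ((mem₁ hden (.proj L)).and (h.lt (.proj L) (.proj L))) (.proj L)
        ((mem₁ hden (.proj L)).and (h.lt (.proj L) (.proj L)))))).and
      (h.hasDigit hpos i (.proj L) (.proj L) (.proj L) (.proj L) (.proj L))))))

theorem IsOstrowski.mem_digitRel_iff {b : ℕ → ℕ} {c : ℝ} {l i : ℕ} (hb : IsOstrowski a b c)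
    (ha : Irrational a) (hc : c ∈ Set.Ico (1 - a) (2 - a)) (hl : 1 ≤ l) :
    ((convDen a l : ℝ) * a, c) ∈ digitRel a i ↔ b l = i := by
  obtain ⟨k, rfl⟩ := Nat.exists_eq_add_of_le' hl
  constructor
  · rintro ⟨-, l, b', hl', hden, hb', rfl⟩
    obtain ⟨k', rfl⟩ := Nat.exists_eq_add_of_le' hl'
    rw [injective_convDen_succ_mul ha hden, hb.eq ha hb']
  · exact fun hdigit => ⟨hc, k + 1, b, hl, rfl, hb, hdigit⟩

theorem convDen_mul_mem_oddDen_iff (ha : Irrational a) {l : ℕ} (hl : 1 ≤ l) :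
    (convDen a l : ℝ) * a ∈ oddDen a ↔ Odd l := by
  obtain ⟨k, rfl⟩ := Nat.exists_eq_add_of_le' hl
  refine ⟨?_, fun hodd => ⟨k + 1, hodd, rfl⟩⟩
  rintro ⟨l, hodd, hden⟩
  obtain ⟨k', rfl⟩ := Nat.exists_eq_add_of_le' hodd.pos
  rwa [injective_convDen_succ_mul ha hden]

theorem mem_oddDigitSet_iff (ha : Irrational a) (hlow : 3 / 2 < a) (hhigh : a < 2) {c : ℝ} :
    c ∈ oddDigitSet a ↔ c ∈ Set.Ico (1 - a) (2 - a) ∧ ∀ x, x ∈ bestDen a →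
      ((x, c) ∈ digitRel a 0 ∨ (x, c) ∈ digitRel a 1) ∧ (x ∉ oddDen a → (x, c) ∈ digitRel a 0) := by
  have hpos : 0 < a := by linarith
  refine and_congr_right fun hc => ?_
  obtain ⟨b, hb, huniq⟩ := existsUnique_isOstrowski_of_mem_Ico ha (by linarith) hhigh hc
  have hdigit : ∀ k i, ((convDen a (k + 1) : ℝ) * a, c) ∈ digitRel a i ↔ b (k + 1) = i :=
    fun k i => hb.mem_digitRel_iff ha hc k.succ_pos
  simp only [bestDen_eq_range ha hpos (partialQuot_one hlow hhigh), Set.forall_mem_range, hdigit,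
    convDen_mul_mem_oddDen_iff ha (Nat.succ_pos _), Nat.not_odd_iff_even]
  constructor
  · rintro ⟨b', hb', hdigits⟩ k
    exact huniq b' hb' ▸ hdigits (k + 1) k.succ_pos
  · refine fun hdigits => ⟨b, hb, fun l hl => ?_⟩
    obtain ⟨k, rfl⟩ := Nat.exists_eq_add_of_le' hl
    exact hdigits k

theorem DefinesLattice.definable_oddDigitSet (h : DefinesLattice L a) (ha : Irrational a)
    (hlow : 3 / 2 < a) (hhigh : a < 2) : (∅ : Set ℝ).Definable₁ L (oddDigitSet a) := by
  have hpos : 0 < a := by linarith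
  refine DefinablePred.congr ?_ fun v => mem_oddDigitSet_iff ha hlow hhigh
  have hdigit := h.definable_digitRel ha hlow hhigh
  exact (mem₁ (h.definable_Ico hpos) (.proj L)).and (all
    ((mem₁ (h.definable_bestDen hpos) (.proj L)).imp
      (((mem₂ (hdigit 0) (.proj L) (.proj L)).or (mem₂ (hdigit 1) (.proj L) (.proj L))).and
        ((mem₁ (h.definable_oddDen ha hpos (partialQuot_one hlow hhigh)) (.proj L)).not.imp
          (mem₂ (hdigit 0) (.proj L) (.proj L))))))

end Definability

/-! ### The copy of the Büchi structure -/

section BuchiCopy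

open DefinablePred

variable {L : FirstOrder.Language} {M : Type*} [L.Structure M]

theorem eq_sumElim_fin_one_iff {X : Type*} {v : Fin 1 ⊕ Fin 1 → X} {f g : Fin 1 → X} :
    v = Sum.elim f g ↔ (v (Sum.inl 0), v (Sum.inr 0)) = (f 0, g 0) := by
  simp [funext_iff]

theorem BuchiSig.IsIso.definesCopyOfBuchi {W J : Set M} {A : BuchiSig W J} {h₁ : W → ℕ}
    {h₂ : J → Set ℕ} {R : Set (M × M)} (hiso : A.IsIso buchi h₁ h₂)
    (hW : (∅ : Set M).Definable₁ L W) (hJ : (∅ : Set M).Definable₁ L J)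
    (hsucc : (∅ : Set M).Definable₂ L {z | ∃ x : W, z = ((x : M), (A.succ x : M))})
    (hR : (∅ : Set M).Definable₂ L R) (hmem : ∀ x c, A.mem x c ↔ ((x : M), (c : M)) ∈ R) :
    DefinesCopyOfBuchi L M := by
  let e (S : Set M) : {v : Fin 1 → M | v 0 ∈ S} ≃ S :=
    (Equiv.funUnique (Fin 1) M).subtypeEquiv fun _ => Iff.rfl
  have he : ∀ (S : Set M) (x : S), ((e S).symm x : Fin 1 → M) 0 = x := fun _ _ => rfl
  refine ⟨1, 1, {v | v 0 ∈ W}, {v | v 0 ∈ J},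
    { succ := fun x => (e W).symm (A.succ (e W x)), mem := fun x c => A.mem (e W x) (e J c) },
    ⟨hW, hJ, ?_, ?_⟩, h₁ ∘ e W, h₂ ∘ e J, hiso.bijective_fst.comp (e W).bijective,
    hiso.bijective_snd.comp (e J).bijective, fun x => ?_, fun x c => hiso.map_mem _ _⟩
  · refine DefinablePred.congr (mem₂ hsucc (.proj L (i := Sum.inl 0)) (.proj L (i := Sum.inr 0)))
      fun v => (exists_congr fun x => eq_sumElim_fin_one_iff).trans ?_
    exact (e W).exists_congr_left.trans (by
      simp only [Equiv.apply_symm_apply, he, Set.mem_ofPred_eq])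
  · refine DefinablePred.congr ((mem₁ hW (.proj L (i := Sum.inl 0))).and
      ((mem₁ hJ (.proj L (i := Sum.inr 0))).and
      (mem₂ hR (.proj L (i := Sum.inl 0)) (.proj L (i := Sum.inr 0))))) fun v => ?_
    simp only [Set.mem_ofPred_eq, eq_sumElim_fin_one_iff, hmem, Prod.mk.injEq]
    constructor
    · rintro ⟨x, c, hxc, hx, hc⟩
      rw [hx, hc]
      exact ⟨x.2, c.2, hxc⟩
    · rintro ⟨hx, hc, hxc⟩
      exact ⟨⟨fun _ => v (Sum.inl 0), hx⟩, ⟨fun _ => v (Sum.inr 0), hc⟩, hxc, rfl, rfl⟩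
  · simp only [Function.comp_apply, Equiv.apply_symm_apply, hiso.map_succ]

end BuchiCopy

section OddDenominators

open DefinablePred

variable {a : ℝ}

/-- The enumeration `k ↦ q_{2k+1} a` of the set of all `q_l a` with `l` odd. -/
noncomputable def oddDenEquiv (ha : Irrational a) : ℕ ≃ oddDen a :=
  (Equiv.ofInjective _ (injective_convDen_odd_mul ha)).trans
    (Equiv.setCongr (oddDen_eq_range a).symm)

/-- The structure `(W, J', s_W, E₁)`. -/
noncomputable def oddBuchi (ha : Irrational a) :
    BuchiSig (oddDen a) (oddDigitSet a) where
  succ x := oddDenEquiv ha ((oddDenEquiv ha).symm x + 1)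
  mem x c := ((x : ℝ), (c : ℝ)) ∈ digitRel a 1

/-- The set of all `k` such that the digit of `c` at `β_{2k+1}` is `1`. -/
def oddDigitSupport (a c : ℝ) : Set ℕ :=
  {k | ((convDen a (2 * k + 1) : ℝ) * a, c) ∈ digitRel a 1}

theorem oddDenEquiv_symm_eq (ha : Irrational a) {x : oddDen a} {k : ℕ}
    (hx : (x : ℝ) = convDen a (2 * k + 1) * a) : (oddDenEquiv ha).symm x = k :=
  (Equiv.symm_apply_eq _).2 (Subtype.ext hx)

theorem isLeast_oddBuchi_succ (ha : Irrational a) (hpos : 0 < a) (x : oddDen a) :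
    IsLeast {y : ℝ | y ∈ oddDen a ∧ (x : ℝ) < y} ((oddBuchi ha).succ x : ℝ) := by
  obtain ⟨k, rfl⟩ := (oddDenEquiv ha).surjective x
  simp only [oddBuchi, Equiv.symm_apply_apply, oddDen_eq_range]
  exact isLeast_range_gt_of_strictMono (strictMono_convDen_odd_mul ha hpos) k

theorem mem_graph_oddBuchi_succ_iff (ha : Irrational a) (hpos : 0 < a) {x y : ℝ} :
    (x, y) ∈ {z : ℝ × ℝ | ∃ x : oddDen a, z = ((x : ℝ), ((oddBuchi ha).succ x : ℝ))} ↔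
      x ∈ oddDen a ∧ IsLeast {w | w ∈ oddDen a ∧ x < w} y := by
  constructor
  · rintro ⟨x, hx⟩
    obtain ⟨rfl, rfl⟩ := Prod.mk.inj hx
    exact ⟨x.2, isLeast_oddBuchi_succ ha hpos x⟩
  · rintro ⟨hx, hleast⟩
    exact ⟨⟨x, hx⟩, Prod.ext rfl (hleast.unique (isLeast_oddBuchi_succ ha hpos ⟨x, hx⟩))⟩

theorem DefinesLattice.definable_oddBuchi_succ {L : FirstOrder.Language} [L.Structure ℝ]
    (h : DefinesLattice L a) (ha : Irrational a) (hpos : 0 < a) (hquot : partialQuot a 1 = 1) :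
    (∅ : Set ℝ).Definable₂ L
      {z | ∃ x : oddDen a, z = ((x : ℝ), ((oddBuchi ha).succ x : ℝ))} := by
  refine DefinablePred.congr ?_ fun v => mem_graph_oddBuchi_succ_iff ha hpos
  have hodd := h.definable_oddDen ha hpos hquot
  exact (mem₁ hodd (.proj L)).and (h.isLeast ((mem₁ hodd (.proj L)).and (h.lt (.proj L) (.proj L)))
    (.proj L) ((mem₁ hodd (.proj L)).and (h.lt (.proj L) (.proj L))))

theorem IsOstrowski.mem_oddDigitSupport_iff {b : ℕ → ℕ} {c : ℝ} (hb : IsOstrowski a b c)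
    (ha : Irrational a) (hc : c ∈ Set.Ico (1 - a) (2 - a)) {k : ℕ} :
    k ∈ oddDigitSupport a c ↔ b (2 * k + 1) = 1 :=
  hb.mem_digitRel_iff ha hc (Nat.le_add_left 1 _)

theorem injective_oddDigitSupport (ha : Irrational a) (hquot : partialQuot a 1 = 1) :
    Function.Injective fun c : oddDigitSet a => oddDigitSupport a c := by
  rintro ⟨c, hc, b, hb, hdigits⟩ ⟨c', hc', b', hb', hdigits'⟩ hsupp
  have hzero : ∀ {b c}, IsOstrowski a b c → b 0 = 0 := fun h => by
    have := h.zero_lt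
    omega
  obtain rfl : b = b' := by
    funext l
    rcases Nat.eq_zero_or_pos l with rfl | hl
    · rw [hzero hb, hzero hb']
    rcases Nat.even_or_odd l with heven | ⟨k, rfl⟩
    · rw [(hdigits l hl).2 heven, (hdigits' l hl).2 heven]
    · have hiff : b (2 * k + 1) = 1 ↔ b' (2 * k + 1) = 1 := by
        rw [← hb.mem_oddDigitSupport_iff ha hc, ← hb'.mem_oddDigitSupport_iff ha hc']
        exact Set.ext_iff.1 hsupp k
      have := (hdigits _ hl).1
      have := (hdigits' _ hl).1
      omega
  exact Subtype.ext (hb.hasSum.unique hb'.hasSum)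

theorem surjective_oddDigitSupport (ha : Irrational a) (hlow : 1 ≤ a) (hhigh : a < 2) :
    Function.Surjective fun c : oddDigitSet a => oddDigitSupport a c := by
  classical
  intro X
  let b : ℕ → ℕ := fun l => if ∃ k ∈ X, l = 2 * k + 1 then 1 else 0
  have hdigit : ∀ l, b l = 0 ∨ b l = 1 := fun l => (ite_eq_or_eq _ 1 0).symm
  have heven : ∀ l, Even l → b l = 0 := fun l hl => if_neg fun ⟨k, _, hk⟩ =>
    Nat.not_even_iff_odd.2 ⟨k, hk⟩ hl
  have hle : ∀ l, (b l : ℤ) ≤ partialQuot a (l + 1) := fun l => by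
    have := one_le_partialQuot_succ ha l
    have := hdigit l
    omega
  obtain ⟨c, hb⟩ := exists_isOstrowski_of_even_eq_zero ha hle heven
  have hc : c ∈ Set.Ico (1 - a) (2 - a) := Ico_one_sub_two_sub hlow hhigh ▸ hb.mem_Ico ha
  refine ⟨⟨c, hc, b, hb, fun l _ => ⟨hdigit l, heven l⟩⟩, ?_⟩
  ext k
  rw [hb.mem_oddDigitSupport_iff ha hc]
  simp [b]

theorem isIso_oddBuchi (ha : Irrational a) (hlow : 3 / 2 < a) (hhigh : a < 2) :
    (oddBuchi ha).IsIso buchi (oddDenEquiv ha).symm fun c => oddDigitSupport a c where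
  bijective_fst := (oddDenEquiv ha).symm.bijective
  bijective_snd := ⟨injective_oddDigitSupport ha (partialQuot_one hlow hhigh),
    surjective_oddDigitSupport ha (by linarith) hhigh⟩
  map_succ _ := (oddDenEquiv ha).symm_apply_apply _
  map_mem x c := by
    obtain ⟨k, rfl⟩ := (oddDenEquiv ha).surjective x
    rw [Equiv.symm_apply_apply]
    rfl

theorem DefinesLattice.definesCopyOfBuchi {L : FirstOrder.Language} [L.Structure ℝ]
    (h : DefinesLattice L a) (ha : Irrational a) (hlow : 3 / 2 < a) (hhigh : a < 2) :
    DefinesCopyOfBuchi L ℝ :=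
  have hpos : 0 < a := by linarith
  have hquot := partialQuot_one hlow hhigh
  (isIso_oddBuchi ha hlow hhigh).definesCopyOfBuchi (h.definable_oddDen ha hpos hquot)
    (h.definable_oddDigitSet ha hlow hhigh) (h.definable_oddBuchi_succ ha hpos hquot)
    (h.definable_digitRel ha hlow hhigh 1) fun _ _ => Iff.rfl

theorem exists_rat_mul_mem_Ioo {a x y : ℝ} (ha : a ≠ 0) (hxy : x < y) :
    ∃ r : ℚ, x < r * a ∧ r * a < y := by
  rcases lt_or_gt_of_ne ha with hneg | hpos
  · obtain ⟨r, hlow, hhigh⟩ := exists_rat_btwn ((div_lt_div_right_of_neg hneg).2 hxy)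
    exact ⟨r, (lt_div_iff_of_neg hneg).1 hhigh, (div_lt_iff_of_neg hneg).1 hlow⟩
  · obtain ⟨r, hlow, hhigh⟩ := exists_rat_btwn (div_lt_div_of_pos_right hxy hpos)
    exact ⟨r, (div_lt_iff₀ hpos).1 hlow, (lt_div_iff₀ hpos).1 hhigh⟩

theorem definesCopyOfBuchi_structR (ha : Irrational a) :
    @DefinesCopyOfBuchi latticeLang ℝ (structR a) := by
  obtain ⟨r, hlow, hhigh⟩ := exists_rat_mul_mem_Ioo ha.ne_zero (show (3 / 2 : ℝ) < 2 by norm_num)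
  have hr : r ≠ 0 := by
    rintro rfl
    norm_num at hlow
  have hmul : ((r.den : ℤ) : ℝ) * (r * a) = r.num * a := by
    rw [← mul_assoc]
    congr 1
    exact_mod_cast r.den_mul_eq_num
  let := structR a
  exact ((definesLattice_structR a).of_mul_eq (mod_cast r.den_nz) hmul).definesCopyOfBuchi
    (ha.ratCast_mul hr) hlow hhigh

end OddDenominators

theorem theoremD :
    (∀ a : ℝ, Irrational a → @DefinesCopyOfBuchi latticeLang ℝ (structR a)) ∧
    (∀ a : ℝ, Irrational a → 3 / 2 < a → a < 2 →
      -- the set of all `q_k a` with `k ≥ 1` is definable through best approximations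
      DefinableInR₂ a (bestApprox a) ∧
      bestDen a = {x | ∃ k : ℕ, 1 ≤ k ∧ x = convDen a k * a} ∧
      DefinableInR₁ a (bestDen a) ∧
      -- Ostrowski digits exist, are unique, and the digits `0` and `1` are definable
      (∀ c ∈ Set.Ico (1 - a) (2 - a), ∃! b : ℕ → ℕ, IsOstrowski a b c) ∧
      DefinableInR₂ a (digitRel a 0) ∧
      DefinableInR₂ a (digitRel a 1) ∧
      -- the copy `(W, J', s_W, E₁)` of the Büchi structure, and its isomorphism
      DefinableInR₁ a (oddDen a) ∧
      DefinableInR₁ a (oddDigitSet a) ∧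
      ∃ (s : oddDen a → oddDen a) (h₁ : oddDen a → ℕ) (h₂ : oddDigitSet a → Set ℕ),
        (∀ x : oddDen a, IsLeast {y : ℝ | y ∈ oddDen a ∧ (x : ℝ) < y} (s x : ℝ)) ∧
        DefinableInR₂ a {z | ∃ x : oddDen a, z = ((x : ℝ), (s x : ℝ))} ∧
        (∀ (x : oddDen a) (k : ℕ), (x : ℝ) = convDen a (2 * k + 1) * a → h₁ x = k) ∧
        (∀ c : oddDigitSet a,
          h₂ c = {k : ℕ | ((convDen a (2 * k + 1) : ℝ) * a, (c : ℝ)) ∈ digitRel a 1}) ∧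
        BuchiSig.IsIso
          { succ := s,
            mem := fun (x : oddDen a) (c : oddDigitSet a) => ((x : ℝ), (c : ℝ)) ∈ digitRel a 1 }
          buchi h₁ h₂) := by
  refine ⟨fun a ha => definesCopyOfBuchi_structR ha, fun a ha hlow hhigh => ?_⟩
  have hpos : 0 < a := by linarith
  have hquot := partialQuot_one hlow hhigh
  let := structR a
  have h := definesLattice_structR a
  refine ⟨h.definable_bestApprox hpos, bestDen_eq_ofPred ha hpos hquot, h.definable_bestDen hpos,
    fun c hc => existsUnique_isOstrowski_of_mem_Ico ha (by linarith) hhigh hc,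
    h.definable_digitRel ha hlow hhigh 0, h.definable_digitRel ha hlow hhigh 1,
    h.definable_oddDen ha hpos hquot, h.definable_oddDigitSet ha hlow hhigh,
    (oddBuchi ha).succ, (oddDenEquiv ha).symm, fun c => oddDigitSupport a c,
    isLeast_oddBuchi_succ ha hpos, h.definable_oddBuchi_succ ha hpos hquot,
    fun _ _ hx => oddDenEquiv_symm_eq ha hx, fun _ => rfl, isIso_oddBuchi ha hlow hhigh⟩
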